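/- Let $p$ be a prime, and equip $\mathbb{P}^1(\mathbb{Q}_p)$ with the spherical metric $$\rho([x_1:y_1],[x_2:y_2])=\frac{|x_1y_2-x_2y_1|_p}{\max\{|x_1|_p,|y_1|_p\}\,\max\{|x_2|_p,|y_2|_p\}};$$ a ball is a set $\{x:\rho(x,a)\le p^{-n}\}$ with $a\in\mathbb{P}^1(\mathbb{Q}_p)$ and $n\ge 1$. Let $\phi\in\mathbb{Q}_p(z)$ be a rational map of degree $\deg\phi\ge 2$, the degree being the maximum of the degrees of numerator and denominator in lowest terms. Assume that $\phi$ has good reduction: writing $\phi=f/g$ with $f,g\in\mathbb{Z}_p[z]$ without common factor and such that some coefficient of $f$ or $g$ has absolute value $1$, the reduction $\overline{\phi}=\overline{f}/\overline{g}$ over $\mathbb{F}_p$ has degree $\deg\overline{\phi}=\deg\phi$. A nonempty set $E\subseteq\mathbb{P}^1(\mathbb{Q}_p)$ is called a minimal component of $\phi$ if it is clopen, $\phi(E)\subseteq E$, and for every $x\in E$ the orbit $\{\phi^n(x):n\ge 0\}$ is dense in $E$. The attracting basin of a nonempty set $E$ is the set of points $x$ such that the distance $\rho(\phi^n(x),E)$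 tends to $0$ as $n\to\infty$. Then there is a decomposition into pairwise disjoint sets $$\mathbb{P}^1(\mathbb{Q}_p)=\mathcal{P}\sqcup\mathcal{M}\sqcup\mathcal{B},$$ where $\mathcal{P}$ is the set of all periodic points of $\phi$, and it is finite; $\mathcal{M}=\bigsqcup_i\mathcal{M}_i$ is the union of all minimal components $\mathcal{M}_i$ of $\phi$, which are pairwise disjoint, at most countably many, and each a finite union of balls; and every point of $\mathcal{B}$ lies in the attracting basin of a periodic orbit or of a minimal component. Moreover, the length of every periodic orbit of $\phi$ has one of the forms $$k\ \text{ or }\ k\ell\quad\text{if } p\ge 5,\qquad\qquad k\ \text{ or }\ k\ell\ \text{ or }\ kp\quad\text{if } p=2\text{ or }3,$$ where $k,\ell$ are positive integers with $1\le k\le p+1$ and $\ell\mid(p-1)$. -/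

import Mathlib

open scoped LinearAlgebra.Projectivization Polynomial Topology

noncomputable section

namespace PadicRat

/-! ### Rational maps on the projective line over a field -/

/-- The degree of a rational map: the maximum of the degrees of the numerator and the denominator
in lowest terms. -/
def ratDegree {K : Type*} [Field K] (φ : RatFunc K) : ℕ :=
  max φ.num.natDegree φ.denom.natDegree

/-- The value at `v = (x, y)` of the degree `d` homogenization `∑ aᵢ xⁱ y^(d-i)` of the polynomial
`f = ∑ aᵢ zⁱ`. -/
def homEval {K : Type*} [Field K] (d : ℕ) (f : K[X]) (v : Fin 2 → K) : K :=
  ∑ i ∈ Finset.range (d + 1), f.coeff i * v 0 ^ i * v 1 ^ (d - i)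

theorem homEval_smul {K : Type*} [Field K] (d : ℕ) (f : K[X]) (t : K) (v : Fin 2 → K) :
    homEval d f (t • v) = t ^ d * homEval d f v := by
  unfold homEval
  rw [Finset.mul_sum]
  refine Finset.sum_congr rfl fun i hi => ?_
  have hi' : i ≤ d := Nat.lt_succ_iff.mp (Finset.mem_range.mp hi)
  have : t ^ d = t ^ i * t ^ (d - i) := by rw [← pow_add, Nat.add_sub_cancel' hi']
  simp only [Pi.smul_apply, smul_eq_mul, mul_pow, this]
  ring

theorem homEval_eq_eval {K : Type*} [Field K] {d : ℕ} {f : K[X]} (hf : f.natDegree ≤ d)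
    {v : Fin 2 → K} (hv : v 1 ≠ 0) : homEval d f v = v 1 ^ d * f.eval (v 0 / v 1) := by
  unfold homEval
  rw [Polynomial.eval_eq_sum_range' (Nat.lt_succ_of_le hf), Finset.mul_sum]
  refine Finset.sum_congr rfl fun i hi => ?_
  have hi' : i ≤ d := Nat.lt_succ_iff.mp (Finset.mem_range.mp hi)
  have : v 1 ^ d = v 1 ^ i * v 1 ^ (d - i) := by rw [← pow_add, Nat.add_sub_cancel' hi']
  rw [this, div_pow]
  field_simp

theorem homEval_of_eq_zero {K : Type*} [Field K] (d : ℕ) (f : K[X])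
    {v : Fin 2 → K} (hv : v 1 = 0) : homEval d f v = f.coeff d * v 0 ^ d := by
  unfold homEval
  rw [Finset.sum_eq_single d]
  · simp
  · intro i hi hne
    have hi' : i ≤ d := Nat.lt_succ_iff.mp (Finset.mem_range.mp hi)
    rw [hv, zero_pow (by omega), mul_zero]
  · simp

/-- The homogeneous lift `(x, y) ↦ (F (x, y), G (x, y))` of a rational map `φ = f / g`, where `F`
and `G` are the homogenizations of `f` and `g` of degree `deg φ`. -/
def homLift {K : Type*} [Field K] (φ : RatFunc K) (v : Fin 2 → K) : Fin 2 → K :=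
  ![homEval (ratDegree φ) φ.num v, homEval (ratDegree φ) φ.denom v]

theorem homLift_ne_zero {K : Type*} [Field K] (φ : RatFunc K) {v : Fin 2 → K} (hv : v ≠ 0) :
    homLift φ v ≠ 0 := by
  intro h
  have h0 : homEval (ratDegree φ) φ.num v = 0 := congrFun h 0
  have h1 : homEval (ratDegree φ) φ.denom v = 0 := congrFun h 1
  by_cases hv1 : v 1 = 0
  · have hv0 : v 0 ≠ 0 := by
      intro hv0
      apply hv
      funext i
      fin_cases i
      · exact hv0
      · exact hv1
    rw [homEval_of_eq_zero _ _ hv1] at h0 h1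
    have c0 : φ.num.coeff (ratDegree φ) = 0 :=
      (mul_eq_zero.mp h0).resolve_right (pow_ne_zero _ hv0)
    have c1 : φ.denom.coeff (ratDegree φ) = 0 :=
      (mul_eq_zero.mp h1).resolve_right (pow_ne_zero _ hv0)
    have hd : φ.denom ≠ 0 := φ.denom_ne_zero
    rcases le_total φ.num.natDegree φ.denom.natDegree with hle | hle
    · rw [ratDegree, max_eq_right hle] at c1
      exact hd (Polynomial.leadingCoeff_eq_zero.mp c1)
    · rw [ratDegree, max_eq_left hle] at c0 c1
      have hn : φ.num = 0 := Polynomial.leadingCoeff_eq_zero.mp c0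
      rw [hn, Polynomial.natDegree_zero] at hle c1
      have : φ.denom.natDegree = 0 := Nat.le_zero.mp hle
      rw [← this] at c1
      exact hd (Polynomial.leadingCoeff_eq_zero.mp c1)
  · rw [homEval_eq_eval (show φ.num.natDegree ≤ ratDegree φ from le_max_left _ _) hv1] at h0
    rw [homEval_eq_eval (show φ.denom.natDegree ≤ ratDegree φ from le_max_right _ _) hv1] at h1
    have e0 := (mul_eq_zero.mp h0).resolve_left (pow_ne_zero _ hv1)
    have e1 := (mul_eq_zero.mp h1).resolve_left (pow_ne_zero _ hv1)
    obtain ⟨a, b, hab⟩ := φ.isCoprime_num_denom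
    have := congrArg (Polynomial.eval (v 0 / v 1)) hab
    simp [e0, e1] at this

theorem homLift_smul {K : Type*} [Field K] (φ : RatFunc K) (t : K) (v : Fin 2 → K) :
    homLift φ (t • v) = t ^ ratDegree φ • homLift φ v := by
  funext i
  fin_cases i
  · simpa [homLift] using homEval_smul (ratDegree φ) φ.num t v
  · simpa [homLift] using homEval_smul (ratDegree φ) φ.denom t v

/-- The transformation of the projective line over `K` induced by a rational map. The point `z`
of `K` is `[z : 1]` and the point at infinity is `[1 : 0]`. -/
def ratMap {K : Type*} [Field K] (φ : RatFunc K) :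
    ℙ K (Fin 2 → K) → ℙ K (Fin 2 → K) :=
  Projectivization.lift
    (fun v => Projectivization.mk K (homLift φ v) (homLift_ne_zero φ v.2))
    (fun a b t h => by
      rw [Projectivization.mk_eq_mk_iff']
      exact ⟨t ^ ratDegree φ, by rw [h, homLift_smul]⟩)

/-! ### Good reduction -/

/-- The rational map `φ = f / g` over `ℚ_p`, with `f` and `g` in `ℤ_p[z]` without common factor and
at least one coefficient of `f` or `g` of absolute value `1`, has good reduction: the rational
function `f̄ / ḡ` over `𝔽_p` has the same degree as `φ`. (If `ḡ = 0`, the reduction is the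
constant map `∞`, of degree `0`, and the quotient below is the constant `0`, also of
degree `0`.) -/
def GoodReduction (p : ℕ) [Fact p.Prime] (φ : RatFunc ℚ_[p]) : Prop :=
  ∃ f g : ℤ_[p][X],
    IsCoprime (f.map (algebraMap ℤ_[p] ℚ_[p])) (g.map (algebraMap ℤ_[p] ℚ_[p])) ∧
    φ = algebraMap ℚ_[p][X] (RatFunc ℚ_[p]) (f.map (algebraMap ℤ_[p] ℚ_[p])) /
        algebraMap ℚ_[p][X] (RatFunc ℚ_[p]) (g.map (algebraMap ℤ_[p] ℚ_[p])) ∧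
    g ≠ 0 ∧
    (∃ i, ‖f.coeff i‖ = 1 ∨ ‖g.coeff i‖ = 1) ∧
    ratDegree
      (algebraMap (ZMod p)[X] (RatFunc (ZMod p)) (f.map (PadicInt.toZMod (p := p))) /
        algebraMap (ZMod p)[X] (RatFunc (ZMod p)) (g.map (PadicInt.toZMod (p := p)))) =
      ratDegree φ

/-! ### The projective line over `ℚ_p` with its spherical metric -/

/-- The projective line over `ℚ_p`. -/
abbrev P1 (p : ℕ) [Fact p.Prime] : Type := ℙ ℚ_[p] (Fin 2 → ℚ_[p])

/-- `|x₁ y₂ - x₂ y₁| / (max |x₁| |y₁| * max |x₂| |y₂|)` for vectors `(x₁, y₁)` and `(x₂, y₂)`. -/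
def sphVec (p : ℕ) [Fact p.Prime] (v w : Fin 2 → ℚ_[p]) : ℝ :=
  ‖v 0 * w 1 - w 0 * v 1‖ / (max ‖v 0‖ ‖v 1‖ * max ‖w 0‖ ‖w 1‖)

theorem max_norm_pos (p : ℕ) [Fact p.Prime] {v : Fin 2 → ℚ_[p]} (hv : v ≠ 0) :
    0 < max ‖v 0‖ ‖v 1‖ := by
  by_contra h
  rw [not_lt, max_le_iff, norm_le_zero_iff, norm_le_zero_iff] at h
  apply hv
  funext i
  fin_cases i
  · exact h.1
  · exact h.2

theorem sphVec_comm (p : ℕ) [Fact p.Prime] (v w : Fin 2 → ℚ_[p]) :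
    sphVec p v w = sphVec p w v := by
  unfold sphVec
  rw [norm_sub_rev, mul_comm (max ‖v 0‖ ‖v 1‖)]

theorem sphVec_smul_left (p : ℕ) [Fact p.Prime] {t : ℚ_[p]} (ht : t ≠ 0)
    (v w : Fin 2 → ℚ_[p]) : sphVec p (t • v) w = sphVec p v w := by
  unfold sphVec
  have h1 : (t • v) 0 * w 1 - w 0 * (t • v) 1 = t * (v 0 * w 1 - w 0 * v 1) := by
    simp only [Pi.smul_apply, smul_eq_mul]; ring
  have h2 : max ‖(t • v) 0‖ ‖(t • v) 1‖ = ‖t‖ * max ‖v 0‖ ‖v 1‖ := by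
    simp only [Pi.smul_apply, smul_eq_mul, norm_mul]
    rw [mul_max_of_nonneg _ _ (norm_nonneg t)]
  rw [h1, h2, norm_mul, mul_assoc, mul_div_mul_left _ _ (norm_ne_zero_iff.mpr ht)]

theorem sphVec_triangle (p : ℕ) [Fact p.Prime] {u v w : Fin 2 → ℚ_[p]}
    (hu : u ≠ 0) (hv : v ≠ 0) (hw : w ≠ 0) :
    sphVec p u w ≤ max (sphVec p u v) (sphVec p v w) := by
  have pu := max_norm_pos p hu
  have pv := max_norm_pos p hv
  have pw := max_norm_pos p hw
  unfold sphVec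
  set a := max ‖u 0‖ ‖u 1‖ with ha
  set b := max ‖v 0‖ ‖v 1‖ with hb
  set c := max ‖w 0‖ ‖w 1‖ with hc
  have key : ∀ i : Fin 2, ‖u 0 * w 1 - w 0 * u 1‖ * ‖v i‖ ≤
      max (‖u 0 * v 1 - v 0 * u 1‖ * c) (‖v 0 * w 1 - w 0 * v 1‖ * a) := by
    intro i
    have e : (u 0 * w 1 - w 0 * u 1) * v i =
        (u 0 * v 1 - v 0 * u 1) * w i + (v 0 * w 1 - w 0 * v 1) * u i := by
      fin_cases i <;> simp <;> ring
    rw [← norm_mul, e]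
    refine (Padic.nonarchimedean _ _).trans ?_
    rw [norm_mul, norm_mul]
    refine max_le_max (mul_le_mul_of_nonneg_left ?_ (norm_nonneg _))
      (mul_le_mul_of_nonneg_left ?_ (norm_nonneg _))
    · fin_cases i
      · exact le_max_left _ _
      · exact le_max_right _ _
    · fin_cases i
      · exact le_max_left _ _
      · exact le_max_right _ _
  have key' : ‖u 0 * w 1 - w 0 * u 1‖ * b ≤
      max (‖u 0 * v 1 - v 0 * u 1‖ * c) (‖v 0 * w 1 - w 0 * v 1‖ * a) := by
    rcases max_choice ‖v 0‖ ‖v 1‖ with h | h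
    · rw [hb, h]; exact key 0
    · rw [hb, h]; exact key 1
  rcases le_max_iff.mp key' with h | h
  · refine le_max_of_le_left ?_
    rw [div_le_div_iff₀ (mul_pos pu pw) (mul_pos pu pv)]
    nlinarith [mul_le_mul_of_nonneg_left h pu.le]
  · refine le_max_of_le_right ?_
    rw [div_le_div_iff₀ (mul_pos pu pw) (mul_pos pv pw)]
    nlinarith [mul_le_mul_of_nonneg_left h pw.le]

/-- The spherical metric on the projective line over `ℚ_p`, computed on any homogeneous
coordinates. -/
def sphDist (p : ℕ) [Fact p.Prime] (P Q : P1 p) : ℝ := sphVec p P.rep Q.rep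

theorem sphDist_mk (p : ℕ) [Fact p.Prime] (v w : Fin 2 → ℚ_[p]) (hv : v ≠ 0) (hw : w ≠ 0) :
    sphDist p (Projectivization.mk ℚ_[p] v hv) (Projectivization.mk ℚ_[p] w hw) =
      sphVec p v w := by
  obtain ⟨a, ha⟩ := Projectivization.exists_smul_eq_mk_rep ℚ_[p] v hv
  obtain ⟨b, hb⟩ := Projectivization.exists_smul_eq_mk_rep ℚ_[p] w hw
  unfold sphDist
  rw [← ha, ← hb, Units.smul_def, Units.smul_def, sphVec_smul_left p a.ne_zero, sphVec_comm,
    sphVec_smul_left p b.ne_zero, sphVec_comm]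

theorem sphDist_eq_zero (p : ℕ) [Fact p.Prime] {P Q : P1 p} (h : sphDist p P Q = 0) : P = Q := by
  have hP := P.rep_nonzero
  have hQ := Q.rep_nonzero
  unfold sphDist sphVec at h
  rw [div_eq_zero_iff, norm_eq_zero] at h
  have h' := h.resolve_right (mul_pos (max_norm_pos p hP) (max_norm_pos p hQ)).ne'
  rw [← P.mk_rep, ← Q.mk_rep, Projectivization.mk_eq_mk_iff']
  generalize P.rep = v at *
  generalize Q.rep = w at *
  have h'' : v 0 * w 1 = w 0 * v 1 := sub_eq_zero.mp h'
  by_cases hw : w 0 = 0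
  · have hw1 : w 1 ≠ 0 := by
      intro hw1
      apply hQ
      funext i
      fin_cases i
      · exact hw
      · exact hw1
    refine ⟨v 1 / w 1, ?_⟩
    funext i
    fin_cases i
    · have : v 0 = 0 := by simpa [hw, hw1] using h''
      simp [hw, this]
    · simp [hw1]
  · refine ⟨v 0 / w 0, ?_⟩
    funext i
    fin_cases i
    · simp [hw]
    · simp only [Fin.mk_one, Pi.smul_apply, smul_eq_mul]
      rw [div_mul_eq_mul_div, h'', mul_div_cancel_left₀ _ hw]

instance instMetricSpaceP1 (p : ℕ) [Fact p.Prime] : MetricSpace (P1 p) where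
  dist := sphDist p
  dist_self P := by
    change sphVec p P.rep P.rep = 0
    simp [sphVec]
  dist_comm P Q := sphVec_comm p _ _
  dist_triangle P Q R := by
    refine (sphVec_triangle p P.rep_nonzero Q.rep_nonzero R.rep_nonzero).trans ?_
    refine max_le_add_of_nonneg ?_ ?_ <;> exact div_nonneg (norm_nonneg _)
      (mul_nonneg (le_max_of_le_left (norm_nonneg _)) (le_max_of_le_left (norm_nonneg _)))
  eq_of_dist_eq_zero := sphDist_eq_zero p

/-- The ball `B_n(a)` of radius `p ^ (-n)` centered at `a`, for the spherical metric. -/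
def sphBall (p : ℕ) [Fact p.Prime] (n : ℕ) (a : P1 p) : Set (P1 p) :=
  Metric.closedBall a ((p : ℝ) ^ (-(n : ℤ)))

/-- `E` is the union of finitely many balls `B_n(a)` with `n ≥ 1`. -/
def IsFiniteUnionOfBalls (p : ℕ) [Fact p.Prime] (E : Set (P1 p)) : Prop :=
  ∃ S : Set (ℕ × P1 p), S.Finite ∧ (∀ s ∈ S, 1 ≤ s.1) ∧ E = ⋃ s ∈ S, sphBall p s.1 s.2

/-! ### Dynamics -/

/-- The (forward) orbit of `x` under `T`. -/
def orbit {X : Type*} (T : X → X) (x : X) : Set X := Set.range fun n : ℕ => T^[n] x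

/-- `T : E → E` is a minimal subsystem: `E` is mapped into itself, and the orbit of every point of
`E` is dense in `E`. -/
def IsMinimalSubsystem {X : Type*} [TopologicalSpace X] (T : X → X) (E : Set X) : Prop :=
  Set.MapsTo T E E ∧ ∀ x ∈ E, E ⊆ closure (orbit T x)

/-- A minimal component: a nonempty clopen invariant set on which `T` is minimal. -/
def IsMinimalComponent {X : Type*} [TopologicalSpace X] (T : X → X) (E : Set X) : Prop :=
  E.Nonempty ∧ IsClopen E ∧ IsMinimalSubsystem T E

/-- The attracting basin of a (nonempty) set `E`: the points whose iterates converge to `E`. -/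
def basin {X : Type*} [MetricSpace X] (T : X → X) (E : Set X) : Set X :=
  {x | Filter.Tendsto (fun n : ℕ => Metric.infDist (T^[n] x) E) Filter.atTop (𝓝 0)}

end PadicRat

end

/-! A map with good reduction sends residue discs into residue discs. In the parametrizations
`u ↦ [v + p u w]` of the discs it becomes `u ↦ c + l u + p a u²` modulo `p²`, and this shape is
stable under composition. By the pigeonhole principle every orbit enters a disc that returns to
itself after `k ≤ p + 1` steps, and there the return map `T` is governed by `l`:

* if `p ∣ l`, then `T` is a contraction, and the orbit is attracted by a cycle;
* otherwise some iterate `S` of `T` is so close to the identity that `|Sⁿ u - u| = |n| |S u - u|`.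
  Either `u` is fixed by `S`, or `n ↦ Sⁿ u` imitates the embedding of `ℕ` in `ℤ_p`: then the
  closure of the orbit under the map is a finite union of balls, hence a minimal component.

The exponent of `S` is `p` if `l ≡ 1` modulo `p`, and `p - 1` otherwise; this bounds the periods.
For `p ≥ 5` the exponent `p` does not contribute a period. Periods are therefore bounded, and the
set of periodic points is finite because no iterate of a map of degree `≥ 2` is the identity.
-/

namespace PadicRat

/-! ### Congruence-preserving functions -/

/-- Functions that preserve congruences modulo every ideal; on `ℤ_p` these are the `1`-Lipschitz
functions. They serve as the error terms of the normal form `IsQuadMod`. -/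
@[fun_prop]
def CongruencePreserving {R : Type*} [CommRing R] (e : R → R) : Prop :=
  ∀ u v, u - v ∣ e u - e v

namespace CongruencePreserving

variable {R : Type*} [CommRing R] {e f : R → R}

@[fun_prop]
protected theorem id : CongruencePreserving fun u : R => u := fun _ _ => dvd_rfl

@[fun_prop]
theorem const (c : R) : CongruencePreserving fun _ : R => c := fun u v => by simp

@[fun_prop]
theorem comp (he : CongruencePreserving e) (hf : CongruencePreserving f) :
    CongruencePreserving fun u => e (f u) :=
  fun u v => (hf u v).trans (he _ _)

@[fun_prop]
theorem add (he : CongruencePreserving e) (hf : CongruencePreserving f) :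
    CongruencePreserving fun u => e u + f u := fun u v => by
  simpa only [add_sub_add_comm] using dvd_add (he u v) (hf u v)

@[fun_prop]
theorem mul (he : CongruencePreserving e) (hf : CongruencePreserving f) :
    CongruencePreserving fun u => e u * f u := fun u v => by
  rw [show e u * f u - e v * f v = (e u - e v) * f u + e v * (f u - f v) by ring]
  exact dvd_add ((he u v).mul_right _) ((hf u v).mul_left _)

@[fun_prop]
theorem pow (he : CongruencePreserving e) (n : ℕ) : CongruencePreserving fun u => e u ^ n :=
  fun u v => (he u v).trans (sub_dvd_pow_sub_pow _ _ n)

@[fun_prop]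
theorem eval (P : R[X]) : CongruencePreserving fun u => P.eval u :=
  fun u v => P.sub_dvd_eval_sub u v

theorem of_mul_eq_one (he : CongruencePreserving e) (h : ∀ u, e u * f u = 1) :
    CongruencePreserving f := fun u v => by
  have : f u - f v = (e u - e v) * (-(f u * f v)) := by
    linear_combination (-(f u)) * h v + f v * h u
  exact this ▸ (he u v).mul_right _

end CongruencePreserving

/-! ### Quadratic normal form -/

/-- `T` is the quadratic polynomial `c + l u + π a u²` modulo `π²`, in the strong sense that the
error is `π²` times a congruence-preserving function. -/
def IsQuadMod {R : Type*} [CommRing R] (π c l a : R) (T : R → R) : Prop :=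
  ∃ e, CongruencePreserving e ∧ ∀ u, T u = c + l * u + π * a * u ^ 2 + π ^ 2 * e u

namespace IsQuadMod

variable {R : Type*} [CommRing R] {π c l a c₁ l₁ a₁ c₂ l₂ a₂ : R} {S T : R → R}

@[fun_prop]
theorem congruencePreserving (hT : IsQuadMod π c l a T) : CongruencePreserving T := by
  obtain ⟨e, he, h⟩ := hT
  rw [funext h]
  fun_prop

protected theorem const (c : R) : IsQuadMod π c 0 0 fun _ => c :=
  ⟨fun _ => 0, by fun_prop, fun u => by ring⟩

protected theorem id : IsQuadMod π 0 1 0 fun u => u :=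
  ⟨fun _ => 0, by fun_prop, fun u => by ring⟩

theorem sq_mul {e : R → R} (he : CongruencePreserving e) :
    IsQuadMod π 0 0 0 fun u => π ^ 2 * e u :=
  ⟨e, he, fun u => by ring⟩

theorem add (hS : IsQuadMod π c₁ l₁ a₁ S) (hT : IsQuadMod π c₂ l₂ a₂ T) :
    IsQuadMod π (c₁ + c₂) (l₁ + l₂) (a₁ + a₂) fun u => S u + T u := by
  obtain ⟨e, he, h⟩ := hS
  obtain ⟨f, hf, h'⟩ := hT
  exact ⟨fun u => e u + f u, by fun_prop, fun u => by linear_combination h u + h' u⟩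

theorem const_mul (r : R) (hT : IsQuadMod π c l a T) :
    IsQuadMod π (r * c) (r * l) (r * a) fun u => r * T u := by
  obtain ⟨e, he, h⟩ := hT
  exact ⟨fun u => r * e u, by fun_prop, fun u => by linear_combination r * h u⟩

theorem mul_mul (hS : IsQuadMod π c₁ l₁ a₁ S) (hT : IsQuadMod π c₂ l₂ a₂ T) :
    IsQuadMod π (π * (c₁ * c₂)) (π * (c₁ * l₂ + l₁ * c₂)) (l₁ * l₂) fun u => π * (S u * T u) := by
  have hT' := hT.congruencePreserving
  obtain ⟨e, he, h⟩ := hS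
  obtain ⟨f, hf, h'⟩ := hT
  refine ⟨fun u => (a₁ * u ^ 2 + π * e u) * T u + (c₁ + l₁ * u) * (a₂ * u ^ 2 + π * f u),
    by fun_prop, fun u => ?_⟩
  linear_combination π * T u * h u + π * (c₁ + l₁ * u) * h' u

theorem comp (hS : IsQuadMod π c₂ l₂ a₂ S) (hT : IsQuadMod π c₁ l₁ a₁ T) :
    IsQuadMod π (c₂ + l₂ * c₁ + π * a₂ * c₁ ^ 2) (l₂ * l₁ + 2 * π * a₂ * c₁ * l₁)
      (l₂ * a₁ + a₂ * l₁ ^ 2) (S ∘ T) := by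
  obtain ⟨e, he, h⟩ := hS
  have hST : S ∘ T = fun u => c₂ + l₂ * T u + a₂ * (π * (T u * T u)) + π ^ 2 * e (T u) :=
    funext fun u => by rw [Function.comp_apply, h]; ring
  rw [hST]
  convert (((IsQuadMod.const c₂).add (hT.const_mul l₂)).add ((hT.mul_mul hT).const_mul a₂)).add
    (sq_mul (he.comp hT.congruencePreserving)) using 1 <;> ring

theorem exists_iterate (hT : IsQuadMod π c l a T) (n : ℕ) :
    ∃ c' l' a', IsQuadMod π c' l' a' T^[n] := by
  induction n with
  | zero => exact ⟨_, _, _, IsQuadMod.id⟩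
  | succ n ih =>
    obtain ⟨c', l', a', h⟩ := ih
    exact ⟨_, _, _, h.comp hT⟩

theorem exists_sub_eq (hT : IsQuadMod π c l a T) (u v : R) :
    ∃ s, T u - T v = (u - v) * (l + π * a * (u + v) + π ^ 2 * s) := by
  obtain ⟨e, he, h⟩ := hT
  obtain ⟨s, hs⟩ := he u v
  exact ⟨s, by rw [h, h]; linear_combination π ^ 2 * hs⟩

theorem dvd_sub_affine (hT : IsQuadMod π c l a T) (u : R) : π ∣ T u - (c + l * u) := by
  obtain ⟨e, -, h⟩ := hT
  exact ⟨a * u ^ 2 + π * e u, by rw [h]; ring⟩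

end IsQuadMod

theorem exists_isQuadMod_eval_mul {R : Type*} [CommRing R] (π : R) (P : R[X]) :
    ∃ l a S, IsQuadMod π 0 l a S ∧ ∀ u, P.eval (π * u) = P.eval 0 + π * S u := by
  have hdivX (Q : R[X]) (t : R) : Q.eval t = Q.eval 0 + t * Q.divX.eval t := by
    conv_lhs => rw [← Q.divX_mul_X_add]
    rw [Q.coeff_zero_eq_eval_zero, Polynomial.eval_add, Polynomial.eval_mul_X,
      Polynomial.eval_C]
    ring
  refine ⟨P.divX.eval 0, P.divX.divX.eval 0, fun u => u * P.divX.eval (π * u),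
    ⟨fun u => u ^ 3 * P.divX.divX.divX.eval (π * u), ?_, fun u => ?_⟩, fun u => ?_⟩
  · exact .mul (by fun_prop) ((CongruencePreserving.eval _).comp (by fun_prop))
  · linear_combination u * hdivX P.divX (π * u) + π * u ^ 2 * hdivX P.divX.divX (π * u)
  · linear_combination hdivX P (π * u)

/-- The inverse `i` of `α = a + π A` satisfies `i = i₀ - π i₀ A i` with `i₀ = a⁻¹`; substituting
this twice into `β i` leaves an error divisible by `π²`. -/
theorem exists_isQuadMod_eval_div {R : Type*} [CommRing R] {π : R} {α β : R[X]}
    (hα : ∀ u, IsUnit (α.eval (π * u))) (hβ : π ∣ β.eval 0) :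
    ∃ c l a T, IsQuadMod π c l a T ∧ ∀ u, β.eval (π * u) = π * T u * α.eval (π * u) := by
  obtain ⟨_, _, A, hA, hαA⟩ := exists_isQuadMod_eval_mul π α
  obtain ⟨_, _, B, hB, hβB⟩ := exists_isQuadMod_eval_mul π β
  obtain ⟨b, hb⟩ := hβ
  choose i hi using fun u => (hα u).exists_right_inv
  have hα_cp : CongruencePreserving fun u => α.eval (π * u) :=
    (CongruencePreserving.eval α).comp (by fun_prop)
  have hi_cp : CongruencePreserving i := hα_cp.of_mul_eq_one hi
  have hi_eq (u : R) : i u = i 0 - π * i 0 * A u * i u := by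
    have h0 : α.eval 0 * i 0 = 1 := by simpa only [mul_zero] using hi 0
    linear_combination i 0 * hi u - i u * h0 - i 0 * i u * hαA u
  have hN : IsQuadMod π _ _ _ fun u => b + B u := (IsQuadMod.const b).add hB
  have herr : CongruencePreserving fun u => i 0 ^ 2 * ((b + B u) * A u ^ 2 * i u) := by
    have := hA.congruencePreserving
    have := hB.congruencePreserving
    fun_prop
  refine ⟨_, _, _, _, ((hN.const_mul (i 0)).add ((hN.mul_mul hA).const_mul (-i 0 ^ 2))).add
    (.sq_mul herr), fun u => ?_⟩
  have hT : i 0 * (b + B u) + -i 0 ^ 2 * (π * ((b + B u) * A u)) +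
      π ^ 2 * (i 0 ^ 2 * ((b + B u) * A u ^ 2 * i u)) = (b + B u) * i u := by
    linear_combination (-(b + B u) + π * (b + B u) * i 0 * A u) * hi_eq u
  rw [hT]
  linear_combination hβB u + hb - π * (b + B u) * hi u

/-! ### Local dynamics on `ℤ_p` -/

variable {p : ℕ} [Fact p.Prime]

theorem toZMod_eq_iff_dvd {x y : ℤ_[p]} :
    PadicInt.toZMod x = PadicInt.toZMod y ↔ (p : ℤ_[p]) ∣ x - y := by
  rw [← sub_eq_zero, ← map_sub, ← RingHom.mem_ker, PadicInt.ker_toZMod,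
    PadicInt.maximalIdeal_eq_span_p, Ideal.mem_span_singleton]

theorem toZMod_eq_zero_iff_dvd {x : ℤ_[p]} : PadicInt.toZMod x = 0 ↔ (p : ℤ_[p]) ∣ x := by
  simpa using toZMod_eq_iff_dvd (x := x) (y := 0)

theorem norm_eq_one_of_not_dvd {x : ℤ_[p]} (hx : ¬ (p : ℤ_[p]) ∣ x) : ‖x‖ = 1 :=
  le_antisymm x.norm_le_one (not_lt.mp (mt (PadicInt.norm_lt_one_iff_dvd x).mp hx))

theorem norm_le_of_dvd {x y : ℤ_[p]} (h : x ∣ y) : ‖y‖ ≤ ‖x‖ := by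
  obtain ⟨z, rfl⟩ := h
  rw [norm_mul]
  exact mul_le_of_le_one_right (norm_nonneg _) z.norm_le_one

theorem IsQuadMod.contractingWith {c l a : ℤ_[p]} {T : ℤ_[p] → ℤ_[p]}
    (hT : IsQuadMod (p : ℤ_[p]) c l a T) (hl : (p : ℤ_[p]) ∣ l) :
    ContractingWith (p : NNReal)⁻¹ T := by
  refine ⟨inv_lt_one_of_one_lt₀ (by exact_mod_cast (Fact.out : p.Prime).one_lt),
    LipschitzWith.of_dist_le_mul fun u v => ?_⟩
  obtain ⟨s, hs⟩ := hT.exists_sub_eq u v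
  obtain ⟨m, rfl⟩ := hl
  have hdvd : (p : ℤ_[p]) * (u - v) ∣ T u - T v := ⟨m + a * (u + v) + p * s, by rw [hs]; ring⟩
  simpa [dist_eq_norm] using norm_le_of_dvd hdvd

theorem isFixedPt_of_contractingWith_of_mem_periodicPts {X : Type*} [MetricSpace X]
    {K : NNReal} {T : X → X} (hT : ContractingWith K T) {u : X}
    (hu : u ∈ Function.periodicPts T) : Function.IsFixedPt T u := by
  obtain ⟨n, hn, hfix⟩ := hu
  have hTn : ContractingWith (K ^ n) T^[n] :=
    ⟨pow_lt_one' hT.1 hn.ne', hT.2.iterate n⟩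
  exact hTn.fixedPoint_unique' (hfix.apply_iterate 1) hfix

/-- `S` is the identity modulo `p`, and on every residue disc modulo `p` it is, up to `p²`, a
dilation of ratio `1 + p k`; the condition on `k` only matters for `p = 2`, where it asks for `k`
to be even. For such maps the differences `Sⁿ u - u` behave like those of a translation
(`NearId.norm_iterate_sub`). -/
def NearId (S : ℤ_[p] → ℤ_[p]) : Prop :=
  ∀ u, (p : ℤ_[p]) ∣ S u - u ∧ ∃ k : ℤ_[p], (p : ℤ_[p]) ∣ k * (p.choose 2 : ℕ) ∧
    ∀ x, (p : ℤ_[p]) ∣ x - u → ∃ s, S x - S u = (x - u) * (1 + p * k + p ^ 2 * s)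

theorem IsQuadMod.nearId {c l' a : ℤ_[p]} {S : ℤ_[p] → ℤ_[p]}
    (hS : IsQuadMod (p : ℤ_[p]) c (1 + p * l') a S) (hc : (p : ℤ_[p]) ∣ c)
    (hl' : (p : ℤ_[p]) ∣ l' * (p.choose 2 : ℕ)) : NearId S := by
  intro u
  refine ⟨?_, l' + 2 * a * u, ?_, ?_⟩
  · obtain ⟨r, hr⟩ := hS.dvd_sub_affine u
    obtain ⟨c', rfl⟩ := hc
    exact ⟨c' + l' * u + r, by linear_combination hr⟩
  · have hchoose : p ∣ 2 * p.choose 2 := by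
      rw [Nat.choose_two_right, Nat.mul_div_cancel' (Nat.even_mul_pred_self p).two_dvd]
      exact dvd_mul_right _ _
    have hcast : (p : ℤ_[p]) ∣ 2 * (p.choose 2 : ℕ) := by exact_mod_cast Nat.cast_dvd_cast hchoose
    convert dvd_add hl' (hcast.mul_left (a * u)) using 1
    ring
  · rintro x ⟨d, hd⟩
    obtain ⟨s, hs⟩ := hS.exists_sub_eq x u
    refine ⟨s + a * d, ?_⟩
    rw [hs]
    linear_combination (x - u) * p * a * hd

namespace NearId

variable {S T : ℤ_[p] → ℤ_[p]}

protected theorem id : NearId fun u : ℤ_[p] => u :=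
  fun u => ⟨by simp, 0, by simp, fun x _ => ⟨0, by ring⟩⟩

theorem comp (hS : NearId S) (hT : NearId T) : NearId (S ∘ T) := by
  intro u
  obtain ⟨hTu, k, hk, hkT⟩ := hT u
  obtain ⟨hSu, m, hm, hmS⟩ := hS (T u)
  refine ⟨by simpa using dvd_add hSu hTu, k + m, by rw [add_mul]; exact dvd_add hk hm,
    fun x hx => ?_⟩
  obtain ⟨s, hs⟩ := hkT x hx
  obtain ⟨t, ht⟩ := hmS (T x) (hs ▸ hx.mul_right _)
  refine ⟨s + t + k * m + p * (k * t + m * s) + p ^ 2 * s * t, ?_⟩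
  rw [Function.comp_apply, Function.comp_apply, ht, hs]
  ring

theorem iterate (hS : NearId S) (n : ℕ) : NearId S^[n] := by
  induction n with
  | zero => exact NearId.id
  | succ n ih => exact ih.comp hS

theorem exists_iterate_sub_eq (hS : NearId S) (u : ℤ_[p]) :
    ∃ k : ℤ_[p], (p : ℤ_[p]) ∣ k * (p.choose 2 : ℕ) ∧ ∀ n : ℕ, ∃ r,
      S^[n] u - u = (S u - u) * (n + p * k * (n.choose 2 : ℕ) + p ^ 2 * r) := by
  obtain ⟨hSu, k, hk, hdil⟩ := hS u
  refine ⟨k, hk, fun n => ?_⟩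
  induction n with
  | zero => exact ⟨0, by simp⟩
  | succ n ih =>
    obtain ⟨r, hr⟩ := ih
    obtain ⟨s, hs⟩ := hdil (S^[n] u) (hr ▸ hSu.mul_right _)
    have hchoose : (((n + 1).choose 2 : ℕ) : ℤ_[p]) = n + (n.choose 2 : ℕ) := by
      rw [Nat.choose_succ_succ' n 1, Nat.choose_one_right, Nat.cast_add]
    refine ⟨r + s * n + k ^ 2 * (n.choose 2 : ℕ) + p * k * r + p * k * (n.choose 2 : ℕ) * s
      + p ^ 2 * r * s, ?_⟩
    rw [Function.iterate_succ_apply', hchoose]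
    push_cast
    linear_combination hs + (1 + p * k + p ^ 2 * s) * hr

theorem norm_iterate_sub_of_not_dvd (hS : NearId S) {n : ℕ} (hn : ¬ p ∣ n) (u : ℤ_[p]) :
    ‖S^[n] u - u‖ = ‖S u - u‖ := by
  obtain ⟨k, -, h⟩ := hS.exists_iterate_sub_eq u
  obtain ⟨r, hr⟩ := h n
  have hunit : ¬ (p : ℤ_[p]) ∣ n + p * k * (n.choose 2 : ℕ) + p ^ 2 * r := by
    rw [← toZMod_eq_zero_iff_dvd]
    simpa [ZMod.natCast_eq_zero_iff] using hn
  rw [hr, norm_mul, norm_eq_one_of_not_dvd hunit, mul_one]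

theorem norm_iterate_prime_sub (hS : NearId S) (u : ℤ_[p]) :
    ‖S^[p] u - u‖ = ‖(p : ℤ_[p])‖ * ‖S u - u‖ := by
  obtain ⟨k, ⟨m, hm⟩, h⟩ := hS.exists_iterate_sub_eq u
  obtain ⟨r, hr⟩ := h p
  have hunit : ¬ (p : ℤ_[p]) ∣ 1 + p * (m + r) := by
    rw [← toZMod_eq_zero_iff_dvd]
    simp
  have hfactor : S^[p] u - u = (S u - u) * (p * (1 + p * (m + r))) := by
    linear_combination hr + (S u - u) * p * hm
  rw [hfactor, norm_mul, norm_mul, norm_eq_one_of_not_dvd hunit, mul_one, mul_comm]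

theorem norm_iterate_sub (hS : NearId S) (n : ℕ) (u : ℤ_[p]) :
    ‖S^[n] u - u‖ = ‖(n : ℤ_[p])‖ * ‖S u - u‖ := by
  induction n using Nat.strong_induction_on generalizing S with
  | _ n ih =>
    rcases Nat.eq_zero_or_pos n with rfl | hn
    · simp
    by_cases hpn : p ∣ n
    · obtain ⟨m, rfl⟩ := hpn
      have hm : m < p * m :=
        lt_mul_of_one_lt_left (Nat.pos_of_mul_pos_left hn) (Fact.out : p.Prime).one_lt
      rw [Function.iterate_mul, ih m hm (hS.iterate p), hS.norm_iterate_prime_sub, Nat.cast_mul,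
        norm_mul]
      ring
    · have hcast : ¬ (p : ℤ_[p]) ∣ n := by
        rw [← toZMod_eq_zero_iff_dvd]
        simpa [ZMod.natCast_eq_zero_iff] using hpn
      rw [hS.norm_iterate_sub_of_not_dvd hpn, norm_eq_one_of_not_dvd hcast, one_mul]

theorem isFixedPt_of_mem_periodicPts (hS : NearId S) {u : ℤ_[p]}
    (hu : u ∈ Function.periodicPts S) : Function.IsFixedPt S u := by
  obtain ⟨n, hn, hfix⟩ := hu
  have h := hS.norm_iterate_sub n u
  rw [hfix.eq, sub_self, norm_zero, zero_eq_mul, norm_eq_zero, norm_eq_zero, sub_eq_zero] at h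
  exact h.resolve_left (by exact_mod_cast hn.ne')

theorem isPeriodicPt_of_mem_periodicPts {n : ℕ} (hT : NearId T^[n]) {u : ℤ_[p]}
    (hu : u ∈ Function.periodicPts T) : Function.IsPeriodicPt T n u := by
  obtain ⟨m, hm, hfix⟩ := hu
  refine hT.isFixedPt_of_mem_periodicPts ⟨m, hm, ?_⟩
  rw [Function.IsPeriodicPt, ← Function.iterate_mul, mul_comm]
  exact hfix.mul_const n

end NearId

/-! ### Iterates modulo `p` -/

theorem affine_one_iterate {R : Type*} [CommRing R] (c x : R) (n : ℕ) :
    (fun x => c + 1 * x)^[n] x = x + n * c := by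
  simp [add_left_iterate, add_comm]

theorem affine_iterate {K : Type*} [Field K] {l : K} (hl : l ≠ 1) (c x : K) (n : ℕ) :
    (fun x => c + l * x)^[n] x = c / (1 - l) + l ^ n * (x - c / (1 - l)) := by
  have h1 : 1 - l ≠ 0 := sub_ne_zero.mpr (Ne.symm hl)
  induction n with
  | zero => simp
  | succ n ih =>
    rw [Function.iterate_succ_apply', ih]
    field_simp
    ring

theorem sum_range_add_natCast_mul {c : ZMod p} (hc : c ≠ 0) (u : ZMod p) {M : Type*}
    [AddCommMonoid M] (g : ZMod p → M) :
    ∑ j ∈ Finset.range p, g (u + j * c) = ∑ x, g x := by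
  refine Finset.sum_nbij' (fun j => u + j * c) (fun x => ((x - u) / c).val) (by simp)
    (fun x _ => Finset.mem_range.mpr (ZMod.val_lt _)) (fun j hj => ?_) (fun x _ => ?_) (by simp)
  · rw [add_sub_cancel_left, mul_div_cancel_right₀ _ hc,
      ZMod.val_cast_of_lt (Finset.mem_range.mp hj)]
  · rw [ZMod.natCast_zmod_val, div_mul_cancel₀ _ hc, add_sub_cancel]

namespace IsQuadMod

variable {c l a : ℤ_[p]} {T : ℤ_[p] → ℤ_[p]}

theorem semiconj_toZMod (hT : IsQuadMod (p : ℤ_[p]) c l a T) :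
    Function.Semiconj PadicInt.toZMod T
      fun x => PadicInt.toZMod c + PadicInt.toZMod l * x := fun u => by
  rw [toZMod_eq_iff_dvd.mpr (hT.dvd_sub_affine u), map_add, map_mul]

theorem nearId_of_dvd_sub (hp : p ≠ 2) (hT : IsQuadMod (p : ℤ_[p]) c l a T)
    (h : ∀ u, (p : ℤ_[p]) ∣ T u - u) : NearId T := by
  have hc : (p : ℤ_[p]) ∣ c := by
    simpa using dvd_sub (h 0) (hT.dvd_sub_affine 0)
  obtain ⟨l', hl'⟩ : (p : ℤ_[p]) ∣ l - 1 := by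
    convert dvd_sub (dvd_sub (h 1) (hT.dvd_sub_affine 1)) hc using 1
    ring
  obtain rfl : l = 1 + p * l' := by linear_combination hl'
  have hchoose : p ∣ p.choose 2 := (Fact.out : p.Prime).dvd_choose_self two_ne_zero
    ((Fact.out : p.Prime).two_le.lt_of_ne' hp)
  exact hT.nearId hc ((Nat.cast_dvd_cast hchoose).mul_left _)

theorem nearId_iterate_of_toZMod_ne_one (hp : p ≠ 2) (hT : IsQuadMod (p : ℤ_[p]) c l a T)
    (hl₀ : PadicInt.toZMod l ≠ 0) (hl₁ : PadicInt.toZMod l ≠ 1) : NearId T^[p - 1] := by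
  obtain ⟨c', l', a', h⟩ := hT.exists_iterate (p - 1)
  refine h.nearId_of_dvd_sub hp fun u => toZMod_eq_iff_dvd.mp ?_
  rw [(hT.semiconj_toZMod.iterate_right _).eq, affine_iterate hl₁,
    ZMod.pow_card_sub_one_eq_one hl₀]
  ring

theorem nearId_iterate_two {c l a : ℤ_[2]} {T : ℤ_[2] → ℤ_[2]}
    (hT : IsQuadMod ((2 : ℕ) : ℤ_[2]) c l a T) (hl : PadicInt.toZMod l = 1) : NearId T^[2] := by
  obtain ⟨m, hm⟩ : ((2 : ℕ) : ℤ_[2]) ∣ l - 1 := toZMod_eq_iff_dvd.mp (by rw [hl, map_one])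
  obtain rfl : l = 1 + 2 * m := by push_cast at hm; linear_combination hm
  have hL : (1 + 2 * m) * (1 + 2 * m) + 2 * ((2 : ℕ) : ℤ_[2]) * a * c * (1 + 2 * m) =
      1 + (2 : ℕ) * (2 * (m + m ^ 2 + a * c * (1 + 2 * m))) := by push_cast; ring
  have h2 := hT.comp hT
  rw [hL] at h2
  refine h2.nearId ⟨c * (1 + m) + a * c ^ 2, by push_cast; ring⟩ ?_
  exact ⟨m + m ^ 2 + a * c * (1 + 2 * m), by simp⟩

theorem nearId_iterate_prime (hT : IsQuadMod (p : ℤ_[p]) c l a T)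
    (hl : PadicInt.toZMod l = 1) : NearId T^[p] := by
  by_cases hp : p = 2
  · subst hp
    exact hT.nearId_iterate_two hl
  obtain ⟨c', l', a', h⟩ := hT.exists_iterate p
  refine h.nearId_of_dvd_sub hp fun u => toZMod_eq_iff_dvd.mp ?_
  rw [(hT.semiconj_toZMod.iterate_right _).eq, hl, affine_one_iterate]
  simp

/-- For `p ≥ 5` a nontrivial translation modulo `p` has no point of period `p`: summing
`T x - x = c + p (m x + a x²) + O(p²)` along the orbit, which runs through all residue classes,
gives `p c` modulo `p²`, because the sums of `x` and of `x²` over `𝔽_p` vanish. -/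
theorem dvd_of_iterate_prime_eq (hp : 5 ≤ p) (hT : IsQuadMod (p : ℤ_[p]) c l a T)
    (hl : PadicInt.toZMod l = 1) {u : ℤ_[p]} (hu : T^[p] u = u) : (p : ℤ_[p]) ∣ c := by
  by_contra hc
  rw [← toZMod_eq_zero_iff_dvd] at hc
  have horbit (j : ℕ) : PadicInt.toZMod (T^[j] u) =
      PadicInt.toZMod u + j * PadicInt.toZMod c := by
    rw [(hT.semiconj_toZMod.iterate_right _).eq, hl, affine_one_iterate]
  obtain ⟨e, -, h⟩ := hT
  obtain ⟨m, hm⟩ : (p : ℤ_[p]) ∣ l - 1 := toZMod_eq_iff_dvd.mp (by rw [hl, map_one])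
  have hstep (x : ℤ_[p]) : T x - x = c + p * (m * x + a * x ^ 2 + p * e x) := by
    linear_combination h x + x * hm
  have htelescope : ∑ j ∈ Finset.range p, (T (T^[j] u) - T^[j] u) = 0 := by
    simp_rw [← Function.iterate_succ_apply' T]
    rw [Finset.sum_range_sub (fun j => T^[j] u), hu, Function.iterate_zero_apply, sub_self]
  have hsum : c + ∑ j ∈ Finset.range p,
      (m * T^[j] u + a * T^[j] u ^ 2 + p * e (T^[j] u)) = 0 := by
    simp_rw [hstep] at htelescope
    rw [Finset.sum_add_distrib, ← Finset.mul_sum, Finset.sum_const, Finset.card_range,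
      nsmul_eq_mul, ← mul_add] at htelescope
    exact (mul_eq_zero.mp htelescope).resolve_left
      (by exact_mod_cast (Fact.out : p.Prime).ne_zero)
  have hsum₁ : ∑ x : ZMod p, x = 0 := by
    simpa using FiniteField.sum_pow_lt_card_sub_one (ZMod p) 1 (by rw [ZMod.card]; omega)
  have hsum₂ : ∑ x : ZMod p, x ^ 2 = 0 :=
    FiniteField.sum_pow_lt_card_sub_one (ZMod p) 2 (by rw [ZMod.card]; omega)
  apply hc
  simpa [horbit, Finset.sum_add_distrib, ← Finset.mul_sum,
    sum_range_add_natCast_mul hc _ fun x => x, sum_range_add_natCast_mul hc _ fun x => x ^ 2,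
    hsum₁, hsum₂] using congrArg PadicInt.toZMod hsum

theorem trichotomy (hT : IsQuadMod (p : ℤ_[p]) c l a T) :
    ContractingWith (p : NNReal)⁻¹ T ∨ PadicInt.toZMod l = 1 ∨ NearId T^[p - 1] := by
  by_cases hl₀ : PadicInt.toZMod l = 0
  · exact Or.inl (hT.contractingWith (toZMod_eq_zero_iff_dvd.mp hl₀))
  refine Or.inr (or_iff_not_imp_left.mpr fun hl₁ => ?_)
  refine hT.nearId_iterate_of_toZMod_ne_one ?_ hl₀ hl₁
  rintro rfl
  exact hl₁ (Fin.eq_one_of_ne_zero _ hl₀)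

theorem contractingWith_or_nearId_iterate (hT : IsQuadMod (p : ℤ_[p]) c l a T) :
    ContractingWith (p : NNReal)⁻¹ T ∨ ∃ n, n ≠ 0 ∧ NearId T^[n] := by
  have hp : p.Prime := Fact.out
  rcases hT.trichotomy with h | h | h
  · exact Or.inl h
  · exact Or.inr ⟨p, hp.ne_zero, hT.nearId_iterate_prime h⟩
  · exact Or.inr ⟨p - 1, (Nat.sub_pos_of_lt hp.one_lt).ne', h⟩

theorem nearId_of_iterate_prime_eq (hp : 5 ≤ p) (hT : IsQuadMod (p : ℤ_[p]) c l a T)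
    (hl : PadicInt.toZMod l = 1) {u : ℤ_[p]} (hu : T^[p] u = u) : NearId T := by
  have hc := toZMod_eq_zero_iff_dvd.mpr (hT.dvd_of_iterate_prime_eq hp hl hu)
  refine hT.nearId_of_dvd_sub (by omega) fun v => toZMod_eq_iff_dvd.mp ?_
  simp [hT.semiconj_toZMod v, hc, hl]

theorem minimalPeriod_dvd_or_eq (hT : IsQuadMod (p : ℤ_[p]) c l a T) {u : ℤ_[p]}
    (hu : u ∈ Function.periodicPts T) :
    Function.minimalPeriod T u ∣ p - 1 ∨
      ((p = 2 ∨ p = 3) ∧ Function.minimalPeriod T u = p) := by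
  have hp : p.Prime := Fact.out
  have hfixed (h : Function.IsFixedPt T u) : Function.minimalPeriod T u ∣ p - 1 := by
    rw [Function.minimalPeriod_eq_one_iff_isFixedPt.mpr h]
    exact one_dvd _
  rcases hT.trichotomy with h | hl | h
  · exact Or.inl (hfixed (isFixedPt_of_contractingWith_of_mem_periodicPts h hu))
  · have hper := (hT.nearId_iterate_prime hl).isPeriodicPt_of_mem_periodicPts hu
    rcases (Nat.dvd_prime hp).mp hper.minimalPeriod_dvd with h1 | h1
    · exact Or.inl (h1.symm ▸ one_dvd _)
    by_cases h5 : 5 ≤ p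
    · exact Or.inl (hfixed ((hT.nearId_of_iterate_prime_eq h5 hl hper).isFixedPt_of_mem_periodicPts
        hu))
    · refine Or.inr ⟨?_, h1⟩
      interval_cases p
      all_goals first | omega | exact absurd hp (by norm_num)
  · exact Or.inl (h.isPeriodicPt_of_mem_periodicPts hu).minimalPeriod_dvd

end IsQuadMod

/-! ### Primitive coordinates on the projective line -/

theorem mk_eq_mk_div_one {K : Type*} [Field K] {v : Fin 2 → K} (hv : v ≠ 0) (h1 : v 1 ≠ 0) :
    Projectivization.mk K v hv = Projectivization.mk K ![v 0 / v 1, 1] (by simp) := by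
  rw [Projectivization.mk_eq_mk_iff']
  refine ⟨v 1, funext fun i => ?_⟩
  fin_cases i <;> simp [mul_div_cancel₀ _ h1]

theorem mk_eq_mk_one_div {K : Type*} [Field K] {v : Fin 2 → K} (hv : v ≠ 0) (h0 : v 0 ≠ 0) :
    Projectivization.mk K v hv = Projectivization.mk K ![1, v 1 / v 0] (by simp) := by
  rw [Projectivization.mk_eq_mk_iff']
  refine ⟨v 0, funext fun i => ?_⟩
  fin_cases i <;> simp [mul_div_cancel₀ _ h0]

/-- The exterior product of two vectors of the plane, that is, the determinant of the matrix with
columns `v` and `w`; the numerator of the spherical distance. -/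
def wedge {R : Type*} [CommRing R] (v w : Fin 2 → R) : R := v 0 * w 1 - w 0 * v 1

theorem wedge_add_smul_add_smul {R : Type*} [CommRing R] (v w : Fin 2 → R) (a b : R) :
    wedge (v + a • w) (v + b • w) = (b - a) * wedge v w := by
  simp only [wedge, Pi.add_apply, Pi.smul_apply, smul_eq_mul]
  ring

theorem wedge_smul_eq {R : Type*} [CommRing R] (v w x : Fin 2 → R) :
    wedge v w • x = wedge x w • v + wedge v x • w := by
  ext i
  fin_cases i <;>
    simp only [wedge, Pi.add_apply, Pi.smul_apply, smul_eq_mul, Fin.zero_eta, Fin.mk_one] <;> ring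

theorem not_forall_prime_dvd_of_isCoprime {v : Fin 2 → ℤ_[p]} (hv : IsCoprime (v 0) (v 1)) :
    ¬ ∀ i, (p : ℤ_[p]) ∣ v i := fun h =>
  PadicInt.prime_p.not_isUnit (hv.isUnit_of_dvd' (h 0) (h 1))

/-- The point `[v 0 : v 1]` of the projective line over `ℚ_p`, for coprime `v 0` and `v 1` in
`ℤ_p`. -/
noncomputable def toP1 (v : Fin 2 → ℤ_[p]) (hv : IsCoprime (v 0) (v 1)) : P1 p :=
  Projectivization.mk ℚ_[p] (fun i => (v i : ℚ_[p])) fun h =>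
    not_forall_prime_dvd_of_isCoprime hv fun i => by
      rw [PadicInt.coe_eq_zero.mp (congrFun h i)]
      exact dvd_zero _

theorem max_norm_eq_one_of_isCoprime {v : Fin 2 → ℤ_[p]} (hv : IsCoprime (v 0) (v 1)) :
    max ‖v 0‖ ‖v 1‖ = 1 := by
  refine (max_le (v 0).norm_le_one (v 1).norm_le_one).antisymm (not_lt.mp fun h => ?_)
  simp only [max_lt_iff, PadicInt.norm_lt_one_iff_dvd] at h
  exact not_forall_prime_dvd_of_isCoprime hv (Fin.forall_fin_two.mpr h)

theorem dist_toP1 {v w : Fin 2 → ℤ_[p]} (hv : IsCoprime (v 0) (v 1))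
    (hw : IsCoprime (w 0) (w 1)) : dist (toP1 v hv) (toP1 w hw) = ‖wedge v w‖ := by
  have hv' : max ‖(v 0 : ℚ_[p])‖ ‖(v 1 : ℚ_[p])‖ = 1 := max_norm_eq_one_of_isCoprime hv
  have hw' : max ‖(w 0 : ℚ_[p])‖ ‖(w 1 : ℚ_[p])‖ = 1 := max_norm_eq_one_of_isCoprime hw
  change sphDist p _ _ = _
  rw [toP1, toP1, sphDist_mk, sphVec, hv', hw', mul_one, div_one, wedge, PadicInt.norm_def]
  push_cast
  rfl

theorem toP1_eq_of_smul {v w : Fin 2 → ℤ_[p]} {t : ℤ_[p]} (hv : IsCoprime (v 0) (v 1))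
    (hw : IsCoprime (w 0) (w 1)) (h : v = t • w) : toP1 v hv = toP1 w hw := by
  rw [← dist_eq_zero, dist_toP1, h, norm_eq_zero, wedge]
  simp only [Pi.smul_apply, smul_eq_mul]
  ring

theorem isCoprime_cons_one (z : ℤ_[p]) : IsCoprime (![z, 1] 0) (![z, 1] 1) :=
  isCoprime_one_right

theorem isCoprime_one_cons (z : ℤ_[p]) : IsCoprime (![1, z] 0) (![1, z] 1) :=
  isCoprime_one_left

theorem exists_eq_toP1 (P : P1 p) :
    (∃ z : ℤ_[p], P = toP1 _ (isCoprime_cons_one z)) ∨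
      ∃ b : ℤ_[p], P = toP1 _ (isCoprime_one_cons ((p : ℤ_[p]) * b)) := by
  induction P using Projectivization.ind with | _ v hv
  rcases le_or_gt ‖v 0‖ ‖v 1‖ with h | h
  · have h1 : v 1 ≠ 0 := fun h1 => hv <| funext <| Fin.forall_fin_two.mpr
      ⟨norm_le_zero_iff.mp (by simpa [h1] using h), h1⟩
    have hz : ‖v 0 / v 1‖ ≤ 1 := by
      rw [norm_div]
      exact div_le_one_of_le₀ h (norm_nonneg _)
    refine .inl ⟨⟨v 0 / v 1, hz⟩, ?_⟩
    rw [mk_eq_mk_div_one hv h1, toP1]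
    congr 1
    ext i
    fin_cases i <;> simp
  · have h0 : v 0 ≠ 0 := norm_pos_iff.mp ((norm_nonneg _).trans_lt h)
    have hz : ‖v 1 / v 0‖ < 1 := by
      rwa [norm_div, div_lt_one (norm_pos_iff.mpr h0)]
    obtain ⟨b, hb⟩ := (PadicInt.norm_lt_one_iff_dvd ⟨v 1 / v 0, hz.le⟩).mp hz
    refine .inr ⟨b, ?_⟩
    rw [mk_eq_mk_one_div hv h0, toP1]
    congr 1
    ext i
    fin_cases i
    · simp
    · exact congrArg Subtype.val hb

theorem exists_isCoprime_eq_toP1 (P : P1 p) :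
    ∃ (v : Fin 2 → ℤ_[p]) (hv : IsCoprime (v 0) (v 1)), P = toP1 v hv := by
  rcases exists_eq_toP1 P with ⟨z, hz⟩ | ⟨b, hb⟩
  exacts [⟨_, _, hz⟩, ⟨_, _, hb⟩]

instance : IsUltrametricDist (P1 p) :=
  ⟨fun P Q R => sphVec_triangle p P.rep_nonzero Q.rep_nonzero R.rep_nonzero⟩

theorem dist_le_one (P Q : P1 p) : dist P Q ≤ 1 := by
  obtain ⟨v, hv, rfl⟩ := exists_isCoprime_eq_toP1 P
  obtain ⟨w, hw, rfl⟩ := exists_isCoprime_eq_toP1 Q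
  rw [dist_toP1]
  exact PadicInt.norm_le_one _

instance : CompactSpace (P1 p) := by
  have hzero : Isometry fun z : ℤ_[p] => toP1 _ (isCoprime_cons_one z) :=
    Isometry.of_dist_eq fun z w => by rw [dist_toP1, dist_eq_norm]; simp [wedge]
  have hinfty : Isometry fun z : ℤ_[p] => toP1 _ (isCoprime_one_cons z) :=
    Isometry.of_dist_eq fun z w => by rw [dist_toP1, dist_eq_norm, norm_sub_rev]; simp [wedge]
  have hcover : Set.range (fun z : ℤ_[p] => toP1 _ (isCoprime_cons_one z)) ∪
      Set.range (fun z : ℤ_[p] => toP1 _ (isCoprime_one_cons z)) = Set.univ := by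
    refine Set.eq_univ_of_forall fun P => ?_
    rcases exists_eq_toP1 P with ⟨z, rfl⟩ | ⟨b, rfl⟩
    exacts [.inl ⟨z, rfl⟩, .inr ⟨_, rfl⟩]
  rw [← isCompact_univ_iff, ← hcover]
  exact (isCompact_range hzero.continuous).union (isCompact_range hinfty.continuous)

theorem exists_residue : ∃ r : P1 p → Option (ZMod p), ∀ P Q, r P = r Q → dist P Q < 1 := by
  have hcoord (P : P1 p) : ∃ o : Option (ZMod p),
      (∃ z : ℤ_[p], P = toP1 _ (isCoprime_cons_one z) ∧ o = some (PadicInt.toZMod z)) ∨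
      ∃ b : ℤ_[p], P = toP1 _ (isCoprime_one_cons ((p : ℤ_[p]) * b)) ∧ o = none := by
    rcases exists_eq_toP1 P with ⟨z, hz⟩ | ⟨b, hb⟩
    exacts [⟨_, .inl ⟨z, hz, rfl⟩⟩, ⟨_, .inr ⟨b, hb, rfl⟩⟩]
  choose r hr using hcoord
  refine ⟨r, fun P Q h => ?_⟩
  rcases hr P with ⟨z, rfl, hz⟩ | ⟨b, rfl, hb⟩ <;> rcases hr Q with ⟨w, rfl, hw⟩ | ⟨c, rfl, hc⟩
  · have hzw : (p : ℤ_[p]) ∣ z - w := toZMod_eq_iff_dvd.mp (by simpa [hz, hw] using h)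
    rw [dist_toP1, PadicInt.norm_lt_one_iff_dvd]
    simpa [wedge] using hzw
  · simp [hz, hc] at h
  · simp [hb, hw] at h
  · rw [dist_toP1, PadicInt.norm_lt_one_iff_dvd]
    refine ⟨c - b, ?_⟩
    simp only [wedge, Matrix.cons_val_zero, Matrix.cons_val_one]
    ring

/-! ### Charts on residue discs -/

/-- A basis `v, w` of `ℤ_p²` of determinant `1`, giving the parametrization `u ↦ [v + p u w]` of
the residue disc of `[v]`. -/
structure Chart (p : ℕ) [Fact p.Prime] where
  v : Fin 2 → ℤ_[p]
  w : Fin 2 → ℤ_[p]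
  wedge_eq_one : wedge v w = 1

namespace Chart

variable (C : Chart p)

theorem isCoprime (t : ℤ_[p]) : IsCoprime ((C.v + t • C.w) 0) ((C.v + t • C.w) 1) := by
  have h := C.wedge_eq_one
  refine ⟨C.w 1, -C.w 0, ?_⟩
  simp only [wedge, Pi.add_apply, Pi.smul_apply, smul_eq_mul] at h ⊢
  linear_combination h

/-- The parametrization `u ↦ [v + p u w]` of a residue disc. -/
noncomputable def pt (u : ℤ_[p]) : P1 p := toP1 _ (C.isCoprime (p * u))

theorem dist_pt (u t : ℤ_[p]) : dist (C.pt u) (C.pt t) = ‖u - t‖ / p := by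
  rw [pt, pt, dist_toP1, wedge_add_smul_add_smul, C.wedge_eq_one, mul_one, ← mul_sub, norm_mul,
    PadicInt.norm_p, norm_sub_rev]
  ring

theorem norm_sub_eq (u t : ℤ_[p]) : ‖u - t‖ = p * dist (C.pt u) (C.pt t) := by
  rw [dist_pt, mul_div_cancel₀ _ (by exact_mod_cast (Fact.out : p.Prime).ne_zero)]

theorem dist_pt_le (u t : ℤ_[p]) : dist (C.pt u) (C.pt t) ≤ dist u t := by
  rw [dist_pt, dist_eq_norm]
  exact div_le_self (norm_nonneg _) (by exact_mod_cast (Fact.out : p.Prime).one_le)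

theorem continuous_pt : Continuous C.pt :=
  (LipschitzWith.of_dist_le_mul (K := 1) fun u t => by simpa using C.dist_pt_le u t).continuous

theorem pt_injective : Function.Injective C.pt := fun u t h => by
  rw [← sub_eq_zero, ← norm_eq_zero, C.norm_sub_eq, h, dist_self, mul_zero]

theorem dist_pt_lt_one (u t : ℤ_[p]) : dist (C.pt u) (C.pt t) < 1 := by
  have hp : (1 : ℝ) < p := by exact_mod_cast (Fact.out : p.Prime).one_lt
  rw [dist_pt, div_lt_one (one_pos.trans hp)]
  exact (PadicInt.norm_le_one _).trans_lt hp

theorem eq_smul_add_smul (x : Fin 2 → ℤ_[p]) : x = wedge x C.w • C.v + wedge C.v x • C.w := by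
  rw [← wedge_smul_eq, C.wedge_eq_one, one_smul]

theorem isUnit_wedge_of_dvd {x : Fin 2 → ℤ_[p]} (hx : IsCoprime (x 0) (x 1))
    (h : (p : ℤ_[p]) ∣ wedge C.v x) : IsUnit (wedge x C.w) := by
  rw [PadicInt.isUnit_iff]
  refine norm_eq_one_of_not_dvd fun hdvd => not_forall_prime_dvd_of_isCoprime hx fun i => ?_
  rw [C.eq_smul_add_smul x]
  exact dvd_add (hdvd.mul_right _) (h.mul_right _)

theorem toP1_eq_pt {x : Fin 2 → ℤ_[p]} (hx : IsCoprime (x 0) (x 1)) {t : ℤ_[p]}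
    (ht : wedge C.v x = p * t * wedge x C.w) : toP1 x hx = C.pt t := by
  refine toP1_eq_of_smul (t := wedge x C.w) _ _ ?_
  conv_lhs => rw [C.eq_smul_add_smul x, ht]
  rw [smul_add, smul_smul, mul_comm]

theorem dist_toP1_pt_zero {x : Fin 2 → ℤ_[p]} (hx : IsCoprime (x 0) (x 1)) :
    dist (toP1 x hx) (C.pt 0) = ‖wedge C.v x‖ := by
  rw [dist_comm, pt, dist_toP1]
  simp only [mul_zero, zero_smul, add_zero]

theorem exists_eq_pt {P : P1 p} {u : ℤ_[p]} (h : dist P (C.pt u) < 1) : ∃ t, P = C.pt t := by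
  have h0 : dist P (C.pt 0) < 1 :=
    (dist_triangle_max P (C.pt u) (C.pt 0)).trans_lt (max_lt h (C.dist_pt_lt_one _ _))
  obtain ⟨x, hx, rfl⟩ := exists_isCoprime_eq_toP1 P
  rw [dist_toP1_pt_zero, PadicInt.norm_lt_one_iff_dvd] at h0
  obtain ⟨a, ha⟩ := (C.isUnit_wedge_of_dvd hx h0).exists_left_inv
  obtain ⟨b, hb⟩ := h0
  exact ⟨b * a, C.toP1_eq_pt hx (by linear_combination hb - p * b * ha)⟩

theorem exists_pt_zero_eq (P : P1 p) : ∃ C : Chart p, C.pt 0 = P := by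
  obtain ⟨v, hv, rfl⟩ := exists_isCoprime_eq_toP1 P
  obtain ⟨a, b, hab⟩ := id hv
  refine ⟨⟨v, ![-b, a], ?_⟩, toP1_eq_of_smul (t := 1) _ _ (by simp)⟩
  simp only [wedge, Matrix.cons_val_zero, Matrix.cons_val_one]
  linear_combination hab

end Chart

instance (P : P1 p) : (𝓝[≠] P).NeBot := by
  obtain ⟨C, rfl⟩ := Chart.exists_pt_zero_eq P
  rw [← mem_closure_iff_nhdsWithin_neBot, Metric.mem_closure_iff]
  intro ε hε
  obtain ⟨n, hn⟩ := PadicInt.exists_pow_neg_lt p hε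
  have hne : (p : ℤ_[p]) ^ n ≠ 0 := pow_ne_zero n PadicInt.prime_p.ne_zero
  refine ⟨C.pt (p ^ n), fun h => hne (C.pt_injective h), ?_⟩
  refine (C.dist_pt_le _ _).trans_lt ?_
  rwa [dist_comm, dist_zero_right, PadicInt.norm_p_pow]

/-! ### Maps with an integral lift -/

/-- The polynomial self-map of affine space with components `Φ`. -/
noncomputable def polyMap {R σ : Type*} [CommSemiring R] (Φ : σ → MvPolynomial σ R)
    (v : σ → R) : σ → R :=
  fun i => MvPolynomial.eval v (Φ i)

/-- `φ` is given in homogeneous coordinates by a pair of polynomials over `ℤ_p` whose values at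
coprime arguments are coprime. Homogeneity is implicit in the fact that the pair induces `φ`. -/
def HasIntegralLift (φ : P1 p → P1 p) : Prop :=
  ∃ Φ : Fin 2 → MvPolynomial (Fin 2) ℤ_[p], ∀ (v : Fin 2 → ℤ_[p]) (hv : IsCoprime (v 0) (v 1)),
    ∃ h, φ (toP1 v hv) = toP1 (polyMap Φ v) h

theorem exists_eval_eq_eval_line {R σ : Type*} [CommRing R] (F : MvPolynomial σ R)
    (v w : σ → R) : ∃ A : R[X], ∀ t, A.eval t = MvPolynomial.eval (v + t • w) F := by
  refine ⟨MvPolynomial.aeval (fun i => Polynomial.C (v i) + Polynomial.X * Polynomial.C (w i)) F,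
    fun t => ?_⟩
  rw [MvPolynomial.aeval_def, MvPolynomial.polynomial_eval_eval₂, ← MvPolynomial.eval₂_id]
  congr 1
  · ext r
    simp
  · ext i
    simp [mul_comm t]

namespace HasIntegralLift

variable {φ : P1 p → P1 p}

theorem exists_isQuadMod (hφ : HasIntegralLift φ) {C D : Chart p}
    (h : dist (φ (C.pt 0)) (D.pt 0) < 1) :
    ∃ c l a T, IsQuadMod (p : ℤ_[p]) c l a T ∧ ∀ u, φ (C.pt u) = D.pt (T u) := by
  obtain ⟨Φ, hΦ⟩ := hφ
  choose A hA using fun i => exists_eval_eq_eval_line (Φ i) C.v C.w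
  let x (t : ℤ_[p]) : Fin 2 → ℤ_[p] := fun i => (A i).eval t
  have hx (t : ℤ_[p]) : x t = polyMap Φ (C.v + t • C.w) :=
    funext fun i => hA i t
  have hpt (u : ℤ_[p]) : ∃ h, φ (C.pt u) = toP1 (x (p * u)) h := by
    simpa only [hx, Chart.pt] using hΦ _ (C.isCoprime (p * u))
  let α : ℤ_[p][X] := A 0 * Polynomial.C (D.w 1) - Polynomial.C (D.w 0) * A 1
  let β : ℤ_[p][X] := Polynomial.C (D.v 0) * A 1 - A 0 * Polynomial.C (D.v 1)
  have hα (t : ℤ_[p]) : α.eval t = wedge (x t) D.w := by simp [α, x, wedge]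
  have hβ (t : ℤ_[p]) : β.eval t = wedge D.v (x t) := by simp [β, x, wedge]
  have hβ_dvd (u : ℤ_[p]) : (p : ℤ_[p]) ∣ β.eval (p * u) := by
    obtain ⟨h0, h0'⟩ := hpt 0
    rw [h0', D.dist_toP1_pt_zero, PadicInt.norm_lt_one_iff_dvd, ← hβ, mul_zero] at h
    have hsub : (p : ℤ_[p]) ∣ β.eval (p * u) - β.eval 0 :=
      (by simp : (p : ℤ_[p]) ∣ p * u - 0).trans (Polynomial.sub_dvd_eval_sub _ _ β)
    exact (dvd_iff_dvd_of_dvd_sub hsub).mpr h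
  have hα_unit (u : ℤ_[p]) : IsUnit (α.eval (p * u)) := by
    rw [hα]
    exact D.isUnit_wedge_of_dvd (hpt u).1 (hβ _ ▸ hβ_dvd u)
  obtain ⟨c, l, a, T, hT, hT'⟩ := exists_isQuadMod_eval_div hα_unit (by simpa using hβ_dvd 0)
  refine ⟨c, l, a, T, hT, fun u => ?_⟩
  obtain ⟨hu, hu'⟩ := hpt u
  rw [hu']
  exact D.toP1_eq_pt hu (by rw [← hα, ← hβ, hT'])

theorem lipschitzWith_one (hφ : HasIntegralLift φ) : LipschitzWith 1 φ := by
  refine LipschitzWith.of_dist_le_mul fun P Q => ?_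
  rw [NNReal.coe_one, one_mul]
  rcases lt_or_ge (dist Q P) 1 with h | h
  · obtain ⟨C, rfl⟩ := Chart.exists_pt_zero_eq P
    obtain ⟨D, hD⟩ := Chart.exists_pt_zero_eq (φ (C.pt 0))
    obtain ⟨_, _, _, T, hT, hCD⟩ := hφ.exists_isQuadMod (C := C) (D := D) (by simp [hD])
    obtain ⟨t, rfl⟩ := C.exists_eq_pt h
    rw [hCD, hCD, C.dist_pt, D.dist_pt]
    gcongr
    exact norm_le_of_dvd (hT.congruencePreserving _ _)
  · rw [dist_comm P Q]
    exact (dist_le_one _ _).trans h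

theorem exists_isQuadMod_iterate (hφ : HasIntegralLift φ) {n : ℕ} (hn : n ≠ 0) {C D : Chart p}
    (h : dist (φ^[n] (C.pt 0)) (D.pt 0) < 1) :
    ∃ c l a T, IsQuadMod (p : ℤ_[p]) c l a T ∧ ∀ u, φ^[n] (C.pt u) = D.pt (T u) := by
  induction n, Nat.one_le_iff_ne_zero.mpr hn using Nat.le_induction generalizing D with
  | base => exact hφ.exists_isQuadMod h
  | succ n hn ih =>
    obtain ⟨D', hD'⟩ := Chart.exists_pt_zero_eq (φ^[n] (C.pt 0))
    obtain ⟨_, _, _, T, hT, hT'⟩ := ih (D := D') (by omega) (by simp [hD'])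
    rw [Function.iterate_succ_apply', ← hD'] at h
    obtain ⟨_, _, _, S, hS, hS'⟩ := hφ.exists_isQuadMod h
    exact ⟨_, _, _, S ∘ T, hS.comp hT, fun u => by
      rw [Function.iterate_succ_apply', hT', hS', Function.comp_apply]⟩

end HasIntegralLift

/-! ### Orbits of `1`-Lipschitz maps -/

section Orbit

variable {X : Type*} {φ : X → X}

theorem mapsTo_orbit (φ : X → X) (x : X) : Set.MapsTo φ (orbit φ x) (orbit φ x) := by
  rintro _ ⟨n, rfl⟩
  exact ⟨n + 1, Function.iterate_succ_apply' φ n x⟩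

theorem orbit_subset_of_mapsTo {E : Set X} (hE : Set.MapsTo φ E E) {x : X} (hx : x ∈ E) :
    orbit φ x ⊆ E := by
  rintro _ ⟨n, rfl⟩
  exact hE.iterate n hx

theorem mem_orbit_self (φ : X → X) (x : X) : x ∈ orbit φ x := ⟨0, rfl⟩

theorem finite_orbit_of_mem_periodicPts {x : X} (hx : x ∈ Function.periodicPts φ) :
    (orbit φ x).Finite := by
  refine ((Set.finite_Iio (Function.minimalPeriod φ x)).image fun n => φ^[n] x).subset ?_
  rintro _ ⟨n, rfl⟩
  exact ⟨n % Function.minimalPeriod φ x,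
    Nat.mod_lt _ (Function.minimalPeriod_pos_of_mem_periodicPts hx),
    Function.iterate_mod_minimalPeriod_eq⟩

end Orbit

section Basin

variable {X : Type*} [MetricSpace X] {φ : X → X}

theorem dist_iterate_le (hφ : LipschitzWith 1 φ) (n : ℕ) (a b : X) :
    dist (φ^[n] a) (φ^[n] b) ≤ dist a b := by
  simpa using (hφ.iterate n).dist_le_mul a b

theorem mem_basin_of_iterate {E : Set X} {x : X} (j : ℕ) (h : φ^[j] x ∈ basin φ E) :
    x ∈ basin φ E := by
  refine (Filter.tendsto_add_atTop_iff_nat j).mp ?_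
  simpa only [basin, Set.mem_ofPred_eq, Function.iterate_add_apply] using h

theorem subset_basin_of_mapsTo {E : Set X} (hE : Set.MapsTo φ E E) : E ⊆ basin φ E := fun _ hx =>
  tendsto_const_nhds.congr fun n => (Metric.infDist_zero_of_mem (hE.iterate n hx)).symm

theorem mem_basin_orbit_of_mem_closure (hφ : LipschitzWith 1 φ) {x y : X}
    (h : y ∈ closure (orbit φ x)) : x ∈ basin φ (orbit φ y) := by
  refine Metric.tendsto_atTop.mpr fun ε hε => ?_
  obtain ⟨_, ⟨m, rfl⟩, hm⟩ := Metric.mem_closure_iff.mp h ε hε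
  refine ⟨m, fun n hn => ?_⟩
  obtain ⟨k, rfl⟩ := Nat.exists_eq_add_of_le' hn
  rw [Real.dist_0_eq_abs, abs_of_nonneg Metric.infDist_nonneg, Function.iterate_add_apply]
  calc Metric.infDist (φ^[k] (φ^[m] x)) (orbit φ y)
      ≤ dist (φ^[k] (φ^[m] x)) (φ^[k] y) := Metric.infDist_le_dist_of_mem ⟨k, rfl⟩
    _ ≤ dist (φ^[m] x) y := dist_iterate_le hφ k _ _
    _ < ε := by rwa [dist_comm]

end Basin

section Recurrent

variable {X : Type*} [MetricSpace X] {φ : X → X} {x : X}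

theorem exists_ge_dist_iterate_lt (hx : MapClusterPt x Filter.atTop fun n => φ^[n] x) {ε : ℝ}
    (hε : 0 < ε) (m : ℕ) : ∃ n ≥ m, dist (φ^[n] x) x < ε :=
  Filter.frequently_atTop.mp (mapClusterPt_iff_frequently.mp hx _ (Metric.ball_mem_nhds x hε)) m

theorem dist_iterate_eq_of_mapClusterPt (hφ : LipschitzWith 1 φ)
    (hx : MapClusterPt x Filter.atTop fun n => φ^[n] x) (i a b : ℕ) :
    dist (φ^[i] (φ^[a] x)) (φ^[i] (φ^[b] x)) = dist (φ^[a] x) (φ^[b] x) := by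
  refine le_antisymm (dist_iterate_le hφ _ _ _) (le_of_forall_pos_le_add fun ε hε => ?_)
  obtain ⟨n, hn, hnx⟩ := exists_ge_dist_iterate_lt hx (half_pos hε) i
  have hreturn (c : ℕ) : dist (φ^[n] (φ^[c] x)) (φ^[c] x) < ε / 2 := by
    rw [(Function.Commute.iterate_iterate_self φ n c).eq]
    exact (dist_iterate_le hφ _ _ _).trans_lt hnx
  have hle : dist (φ^[n] (φ^[a] x)) (φ^[n] (φ^[b] x)) ≤
      dist (φ^[i] (φ^[a] x)) (φ^[i] (φ^[b] x)) := by
    obtain ⟨k, rfl⟩ := Nat.exists_eq_add_of_le' hn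
    rw [Function.iterate_add_apply φ k i, Function.iterate_add_apply φ k i]
    exact dist_iterate_le hφ _ _ _
  have htri := dist_triangle4 (φ^[a] x) (φ^[n] (φ^[a] x)) (φ^[n] (φ^[b] x)) (φ^[b] x)
  rw [dist_comm (φ^[a] x) (φ^[n] (φ^[a] x))] at htri
  linarith [hreturn a, hreturn b]

theorem mem_closure_orbit_of_mem_closure_orbit (hφ : LipschitzWith 1 φ)
    (hx : MapClusterPt x Filter.atTop fun n => φ^[n] x) {z : X} (hz : z ∈ closure (orbit φ x)) :
    x ∈ closure (orbit φ z) := by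
  rw [Metric.mem_closure_iff] at hz ⊢
  intro ε hε
  obtain ⟨_, ⟨m, rfl⟩, hm⟩ := hz (ε / 2) (half_pos hε)
  obtain ⟨n, hn, hnx⟩ := exists_ge_dist_iterate_lt hx (half_pos hε) m
  obtain ⟨k, rfl⟩ := Nat.exists_eq_add_of_le' hn
  refine ⟨φ^[k] z, ⟨k, rfl⟩, ?_⟩
  rw [Function.iterate_add_apply, dist_comm] at hnx
  calc dist x (φ^[k] z)
      ≤ dist x (φ^[k] (φ^[m] x)) + dist (φ^[k] (φ^[m] x)) (φ^[k] z) := dist_triangle _ _ _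
    _ < ε / 2 + ε / 2 := add_lt_add hnx (by
        rw [dist_comm]
        exact (dist_iterate_le hφ k _ _).trans_lt hm)
    _ = ε := add_halves ε

theorem isMinimalSubsystem_closure_orbit (hφ : LipschitzWith 1 φ)
    (hx : MapClusterPt x Filter.atTop fun n => φ^[n] x) :
    IsMinimalSubsystem φ (closure (orbit φ x)) := by
  have hmaps (z : X) : Set.MapsTo φ (closure (orbit φ z)) (closure (orbit φ z)) :=
    (mapsTo_orbit φ z).closure hφ.continuous
  refine ⟨hmaps x, fun z hz => closure_minimal ?_ isClosed_closure⟩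
  exact orbit_subset_of_mapsTo (hmaps z) (mem_closure_orbit_of_mem_closure_orbit hφ hx hz)

end Recurrent

section MinimalComponent

variable {X : Type*} [TopologicalSpace X] {φ : X → X}

theorem IsMinimalComponent.eq_closure_orbit {E : Set X} (hE : IsMinimalComponent φ E) {x : X}
    (hx : x ∈ E) : E = closure (orbit φ x) :=
  (hE.2.2.2 x hx).antisymm (closure_minimal (orbit_subset_of_mapsTo hE.2.2.1 hx) hE.2.1.isClosed)

theorem pairwiseDisjoint_isMinimalComponent (φ : X → X) :
    {E | IsMinimalComponent φ E}.PairwiseDisjoint id := by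
  intro E hE F hF hne
  refine Set.disjoint_left.mpr fun x hxE hxF => hne ?_
  rw [hE.eq_closure_orbit hxE, hF.eq_closure_orbit hxF]

theorem IsMinimalComponent.disjoint_periodicPts [T1Space X] [∀ x : X, (𝓝[≠] x).NeBot] {E : Set X}
    (hE : IsMinimalComponent φ E) : Disjoint (Function.periodicPts φ) E := by
  refine Set.disjoint_left.mpr fun x hx hxE => ?_
  have hinf : E.Infinite := infinite_of_mem_nhds x (hE.2.1.isOpen.mem_nhds hxE)
  have hfin := finite_orbit_of_mem_periodicPts hx
  rw [hE.eq_closure_orbit hxE, hfin.isClosed.closure_eq] at hinf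
  exact hinf hfin

end MinimalComponent

/-! ### Orbits that imitate the embedding of `ℕ` in `ℤ_p` -/

theorem dvd_of_norm_le {x y : ℤ_[p]} (h : ‖x‖ ≤ ‖y‖) : y ∣ x := by
  rcases eq_or_ne y 0 with rfl | hy
  · rw [norm_zero, norm_le_zero_iff] at h
    rw [h]
  · have hy' : (y : ℚ_[p]) ≠ 0 := mt PadicInt.coe_eq_zero.mp hy
    have hxy : ‖(x / y : ℚ_[p])‖ ≤ 1 := by
      rw [norm_div]
      exact div_le_one_of_le₀ h (norm_nonneg _)
    exact ⟨⟨x / y, hxy⟩, Subtype.ext (mul_div_cancel₀ _ hy').symm⟩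

theorem denseRange_of_norm_sub_eq {a : ℕ → ℤ_[p]}
    (ha : ∀ n m : ℕ, ‖a n - a m‖ = ‖(n : ℤ_[p]) - m‖) : DenseRange a := by
  intro b
  rw [Metric.mem_closure_range_iff]
  intro ε hε
  obtain ⟨t, ht⟩ := PadicInt.exists_pow_neg_lt p hε
  have : NeZero (p ^ t) := ⟨pow_ne_zero _ (Fact.out : p.Prime).ne_zero⟩
  have htoZModPow (x y : ℤ_[p]) : PadicInt.toZModPow t x = PadicInt.toZModPow t y ↔
      ‖x - y‖ ≤ (p : ℝ) ^ (-(t : ℤ)) := by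
    rw [← sub_eq_zero, ← map_sub, ← RingHom.mem_ker, PadicInt.ker_toZModPow,
      PadicInt.norm_le_pow_iff_mem_span_pow]
  have hinj : Function.Injective fun j : ZMod (p ^ t) => PadicInt.toZModPow t (a j.val) := by
    intro i j hij
    have h := (htoZModPow _ _).mp hij
    rw [ha, ← htoZModPow] at h
    simpa using h
  obtain ⟨j, hj⟩ := Finite.injective_iff_surjective.mp hinj (PadicInt.toZModPow t b)
  refine ⟨j.val, ?_⟩
  rw [dist_comm, dist_eq_norm]
  exact ((htoZModPow _ _).mp hj).trans_lt ht

theorem mem_closure_range_of_norm_sub_eq {u : ℕ → ℤ_[p]} {δ : ℝ}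
    (hu : ∀ n m : ℕ, ‖u n - u m‖ = ‖(n : ℤ_[p]) - m‖ * δ) {w : ℤ_[p]} (hw : ‖w - u 0‖ ≤ δ) :
    w ∈ closure (Set.range u) := by
  obtain rfl : δ = ‖u 1 - u 0‖ := by simp [hu 1 0]
  obtain ⟨b, hb⟩ := dvd_of_norm_le hw
  rcases eq_or_ne (u 1 - u 0) 0 with hD | hD
  · refine subset_closure ⟨0, ?_⟩
    rwa [hD, zero_mul, sub_eq_zero, eq_comm] at hb
  have hdvd (n : ℕ) : u 1 - u 0 ∣ u n - u 0 := dvd_of_norm_le (by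
    rw [hu]
    exact mul_le_of_le_one_left (norm_nonneg _) (PadicInt.norm_le_one _))
  choose a ha using hdvd
  have ha_dense : DenseRange a := denseRange_of_norm_sub_eq fun n m => by
    refine mul_right_cancel₀ (norm_ne_zero_iff.mpr hD) ?_
    rw [← hu, ← norm_mul]
    congr 1
    linear_combination ha m - ha n
  have hw_eq : w = u 0 + (u 1 - u 0) * b := by linear_combination hb
  have hrange : Set.range u = (fun z => u 0 + (u 1 - u 0) * z) '' Set.range a := by
    rw [← Set.range_comp]
    congr 1
    ext1 n
    rw [Function.comp_apply, ← ha, add_sub_cancel]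
  rw [hw_eq, hrange]
  exact image_closure_subset_closure_image (by fun_prop) ⟨b, ha_dense b, rfl⟩

theorem closedBall_subset_closure_range {x : ℕ → P1 p} {δ : ℝ} (hδ : δ < 1)
    (hx : ∀ n m : ℕ, dist (x n) (x m) = ‖(n : ℤ_[p]) - m‖ * δ) :
    Metric.closedBall (x 0) δ ⊆ closure (Set.range x) := by
  obtain ⟨C, hC⟩ := Chart.exists_pt_zero_eq (x 0)
  have hδ₀ : 0 ≤ δ := dist_nonneg.trans_eq (by simpa using hx 1 0)
  have hmem (P : P1 p) (hP : dist P (x 0) ≤ δ) : ∃ t, P = C.pt t :=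
    C.exists_eq_pt (u := 0) (hC ▸ hP.trans_lt hδ)
  have hball (n : ℕ) : dist (x n) (x 0) ≤ δ := by
    rw [hx]
    exact mul_le_of_le_one_left hδ₀ (PadicInt.norm_le_one _)
  choose u hu using fun n => hmem (x n) (hball n)
  obtain rfl : x = C.pt ∘ u := funext hu
  intro P hP
  obtain ⟨w, rfl⟩ := hmem P hP
  have hw : w ∈ closure (Set.range u) := by
    refine mem_closure_range_of_norm_sub_eq (δ := p * δ) (fun n m => ?_) ?_
    · rw [C.norm_sub_eq, mul_left_comm]
      exact congrArg _ (hx n m)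
    · rw [C.norm_sub_eq]
      exact mul_le_mul_of_nonneg_left hP (Nat.cast_nonneg p)
  rw [Set.range_comp]
  exact image_closure_subset_closure_image C.continuous_pt ⟨w, hw, rfl⟩

section Imitation

variable {X : Type*} [MetricSpace X] {φ : X → X} {x : X} {N : ℕ} {δ : ℝ}

theorem mapClusterPt_of_dist_iterate_mul (hN : N ≠ 0)
    (hx : ∀ n : ℕ, dist (φ^[N * n] x) x = ‖(n : ℤ_[p])‖ * δ) :
    MapClusterPt x Filter.atTop fun n => φ^[n] x := by
  have hp : p.Prime := Fact.out
  have htop : Filter.Tendsto (fun t => N * p ^ t) Filter.atTop Filter.atTop :=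
    (tendsto_pow_atTop_atTop_of_one_lt hp.one_lt).const_mul_atTop' (Nat.pos_of_ne_zero hN)
  refine MapClusterPt.of_comp htop (Filter.Tendsto.mapClusterPt ?_)
  rw [tendsto_iff_dist_tendsto_zero]
  have hpow : Filter.Tendsto (fun t : ℕ => ((p : ℝ)⁻¹) ^ t * δ) Filter.atTop (𝓝 (0 * δ)) :=
    (tendsto_pow_atTop_nhds_zero_of_lt_one (by positivity)
      (inv_lt_one_of_one_lt₀ (by exact_mod_cast hp.one_lt))).mul_const δ
  simpa [Function.comp_def, hx] using hpow

theorem dist_iterate_mul (hφ : LipschitzWith 1 φ) (hN : N ≠ 0)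
    (hx : ∀ n : ℕ, dist (φ^[N * n] x) x = ‖(n : ℤ_[p])‖ * δ) (i n m : ℕ) :
    dist (φ^[N * n] (φ^[i] x)) (φ^[N * m] (φ^[i] x)) = ‖(n : ℤ_[p]) - m‖ * δ := by
  wlog hmn : m ≤ n generalizing n m
  · rw [dist_comm, norm_sub_rev, this m n (by omega)]
  obtain ⟨k, rfl⟩ := Nat.exists_eq_add_of_le hmn
  calc dist (φ^[N * (m + k)] (φ^[i] x)) (φ^[N * m] (φ^[i] x))
      = dist (φ^[N * m + i] (φ^[N * k] x)) (φ^[N * m + i] (φ^[0] x)) := by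
        simp only [← Function.iterate_add_apply]
        ring_nf
    _ = dist (φ^[N * k] x) x :=
        dist_iterate_eq_of_mapClusterPt hφ (mapClusterPt_of_dist_iterate_mul hN hx) _ _ _
    _ = ‖((m + k : ℕ) : ℤ_[p]) - m‖ * δ := by rw [hx, Nat.cast_add, add_sub_cancel_left]

end Imitation

theorem closure_orbit_eq_biUnion_closedBall {φ : P1 p → P1 p} (hφ : LipschitzWith 1 φ) {N : ℕ}
    (hN : N ≠ 0) {x : P1 p} {δ : ℝ} (hδ₀ : 0 ≤ δ) (hδ₁ : δ < 1)
    (hx : ∀ n : ℕ, dist (φ^[N * n] x) x = ‖(n : ℤ_[p])‖ * δ) :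
    closure (orbit φ x) = ⋃ i ∈ Finset.range N, Metric.closedBall (φ^[i] x) δ := by
  refine Set.Subset.antisymm ?_ (Set.iUnion₂_subset fun i _ => ?_)
  · refine closure_minimal ?_ (isClosed_biUnion_finset fun i _ => Metric.isClosed_closedBall)
    rintro _ ⟨n, rfl⟩
    refine Set.mem_iUnion₂.mpr ⟨n % N,
      Finset.mem_range.mpr (Nat.mod_lt _ (Nat.pos_of_ne_zero hN)), ?_⟩
    have h := dist_iterate_mul hφ hN hx (n % N) (n / N) 0
    rw [← Function.iterate_add_apply, Nat.div_add_mod] at h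
    exact h.trans_le (mul_le_of_le_one_left hδ₀ (PadicInt.norm_le_one _))
  · refine (closedBall_subset_closure_range (x := fun n => φ^[N * n] (φ^[i] x)) hδ₁
      (dist_iterate_mul hφ hN hx i)).trans (closure_mono ?_)
    rintro _ ⟨n, rfl⟩
    exact ⟨N * n + i, Function.iterate_add_apply _ _ _ _⟩

theorem isMinimalComponent_closure_orbit {φ : P1 p → P1 p} (hφ : LipschitzWith 1 φ) {N : ℕ}
    (hN : N ≠ 0) {x : P1 p} {δ : ℝ} (hδ₀ : 0 < δ) (hδ₁ : δ < 1)
    (hx : ∀ n : ℕ, dist (φ^[N * n] x) x = ‖(n : ℤ_[p])‖ * δ) :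
    IsMinimalComponent φ (closure (orbit φ x)) := by
  refine ⟨⟨x, subset_closure (mem_orbit_self φ x)⟩, ⟨isClosed_closure, ?_⟩,
    isMinimalSubsystem_closure_orbit hφ (mapClusterPt_of_dist_iterate_mul hN hx)⟩
  rw [closure_orbit_eq_biUnion_closedBall hφ hN hδ₀.le hδ₁ hx]
  exact isOpen_biUnion fun i _ => IsUltrametricDist.isOpen_closedBall _ hδ₀.ne'

/-! ### Attractors and periods of maps with an integral lift -/

theorem exists_dist_iterate_lt_one (φ : P1 p → P1 p) (x : P1 p) :
    ∃ i k, k ≠ 0 ∧ k ≤ p + 1 ∧ dist (φ^[k] (φ^[i] x)) (φ^[i] x) < 1 := by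
  obtain ⟨r, hr⟩ := exists_residue (p := p)
  have hcard : Fintype.card (Option (ZMod p)) < Fintype.card (Fin (p + 2)) := by simp [ZMod.card]
  obtain ⟨i, j, hij, hrij⟩ :=
    Fintype.exists_ne_map_eq_of_card_lt (fun i : Fin (p + 2) => r (φ^[i] x)) hcard
  wlog hlt : i < j generalizing i j
  · exact this j i hij.symm hrij.symm (lt_of_le_of_ne (not_lt.mp hlt) hij.symm)
  refine ⟨i, j - i, by omega, by omega, ?_⟩
  rw [← Function.iterate_add_apply, Nat.sub_add_cancel (Fin.le_def.mp hlt.le)]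
  exact hr _ _ hrij.symm

theorem minimalPeriod_eq_of_semiconj {α β : Type*} {f : α → β} {T : α → α} {S : β → β}
    (hf : Function.Injective f) (h : Function.Semiconj f T S) (x : α) :
    Function.minimalPeriod S (f x) = Function.minimalPeriod T x := by
  rw [Function.minimalPeriod_eq_minimalPeriod_iff]
  intro n
  rw [Function.IsPeriodicPt, Function.IsFixedPt, ← (h.iterate_right n).eq, hf.eq_iff]
  rfl

namespace HasIntegralLift

variable {φ : P1 p → P1 p}

theorem exists_chart_semiconj (hφ : HasIntegralLift φ) (x : P1 p) :
    ∃ i k, k ≠ 0 ∧ k ≤ p + 1 ∧ ∃ (C : Chart p) (c l a : ℤ_[p]) (T : ℤ_[p] → ℤ_[p]),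
      C.pt 0 = φ^[i] x ∧ IsQuadMod (p : ℤ_[p]) c l a T ∧ Function.Semiconj C.pt T φ^[k] := by
  obtain ⟨i, k, hk₀, hk, hreturn⟩ := exists_dist_iterate_lt_one φ x
  obtain ⟨C, hC⟩ := Chart.exists_pt_zero_eq (φ^[i] x)
  rw [← hC] at hreturn
  obtain ⟨c, l, a, T, hT, hφT⟩ := hφ.exists_isQuadMod_iterate hk₀ hreturn
  exact ⟨i, k, hk₀, hk, C, c, l, a, T, hC, hT, fun u => (hφT u).symm⟩

theorem isMinimalComponent_of_nearId (hφ : HasIntegralLift φ) {C : Chart p} {S : ℤ_[p] → ℤ_[p]}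
    (hS : NearId S) {N : ℕ} (hN : N ≠ 0) (hφS : Function.Semiconj C.pt S φ^[N]) {u : ℤ_[p]}
    (hu : S u ≠ u) : IsMinimalComponent φ (closure (orbit φ (C.pt u))) := by
  have hdist (n : ℕ) : dist (φ^[N * n] (C.pt u)) (C.pt u) =
      ‖(n : ℤ_[p])‖ * dist (C.pt (S u)) (C.pt u) := by
    rw [Function.iterate_mul, ← (hφS.iterate_right n).eq, C.dist_pt, C.dist_pt,
      hS.norm_iterate_sub, mul_div_assoc]
  exact isMinimalComponent_closure_orbit hφ.lipschitzWith_one hN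
    (dist_pos.mpr (C.pt_injective.ne hu)) (C.dist_pt_lt_one _ _) hdist

theorem exists_mem_basin (hφ : HasIntegralLift φ) (x : P1 p) :
    (∃ y ∈ Function.periodicPts φ, x ∈ basin φ (orbit φ y)) ∨
      ∃ E, IsMinimalComponent φ E ∧ x ∈ basin φ E := by
  obtain ⟨i, k, hk, -, C, c, l, a, T, hx, hT, hφT⟩ := hφ.exists_chart_semiconj x
  have hfixed {N : ℕ} (hN : N ≠ 0) {S : ℤ_[p] → ℤ_[p]} {u : ℤ_[p]}
      (hφS : Function.Semiconj C.pt S φ^[N]) (hu : Function.IsFixedPt S u) :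
      C.pt u ∈ Function.periodicPts φ := ⟨N, Nat.pos_of_ne_zero hN, hu.map hφS⟩
  rcases hT.contractingWith_or_nearId_iterate with hcontr | ⟨n, hn, hS⟩
  · refine .inl ⟨C.pt hcontr.fixedPoint, hfixed hk hφT hcontr.fixedPoint_isFixedPt,
      mem_basin_of_iterate i (mem_basin_orbit_of_mem_closure hφ.lipschitzWith_one ?_)⟩
    have hlim := (C.continuous_pt.tendsto _).comp (hcontr.tendsto_iterate_fixedPoint 0)
    refine mem_closure_of_tendsto hlim (.of_forall fun m => ⟨k * m, ?_⟩)
    rw [← hx]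
    change φ^[k * m] (C.pt 0) = C.pt (T^[m] 0)
    rw [Function.iterate_mul, (hφT.iterate_right m).eq]
  · have hφS : Function.Semiconj C.pt T^[n] φ^[k * n] := by
      rw [Function.iterate_mul]
      exact hφT.iterate_right n
    have hkn : k * n ≠ 0 := mul_ne_zero hk hn
    by_cases h₀ : T^[n] 0 = 0
    · exact .inl ⟨C.pt 0, hfixed hkn hφS h₀, mem_basin_of_iterate i
        (hx ▸ subset_basin_of_mapsTo (mapsTo_orbit φ _) (mem_orbit_self φ _))⟩
    · have hE := hφ.isMinimalComponent_of_nearId hS hkn hφS h₀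
      exact .inr ⟨_, hE, mem_basin_of_iterate i
        (hx ▸ subset_basin_of_mapsTo hE.2.2.1 (subset_closure (mem_orbit_self φ _)))⟩

theorem exists_minimalPeriod_eq_mul (hφ : HasIntegralLift φ) {y : P1 p}
    (hy : y ∈ Function.periodicPts φ) :
    ∃ k m, 1 ≤ k ∧ k ≤ p + 1 ∧ (m ∣ p - 1 ∨ ((p = 2 ∨ p = 3) ∧ m = p)) ∧
      Function.minimalPeriod φ y = k * m := by
  obtain ⟨i, k, hk₀, hk, C, c, l, a, T, hz, hT, hφT⟩ := hφ.exists_chart_semiconj y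
  have hz_period : Function.minimalPeriod φ (C.pt 0) = Function.minimalPeriod φ y := by
    rw [hz, Function.minimalPeriod_apply_iterate hy]
  have hT_period : Function.minimalPeriod T 0 =
      Function.minimalPeriod φ y / (Function.minimalPeriod φ y).gcd k := by
    rw [← minimalPeriod_eq_of_semiconj C.pt_injective hφT,
      Function.minimalPeriod_iterate_eq_div_gcd hk₀, hz_period]
  have hT_eq : Function.minimalPeriod φ y =
      (Function.minimalPeriod φ y).gcd k * Function.minimalPeriod T 0 := by
    rw [hT_period, Nat.mul_div_cancel' (Nat.gcd_dvd_left _ _)]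
  have hpos := Function.minimalPeriod_pos_of_mem_periodicPts hy
  have h₀ : (0 : ℤ_[p]) ∈ Function.periodicPts T :=
    Function.minimalPeriod_pos_iff_mem_periodicPts.mp
      (Nat.pos_of_mul_pos_left (hT_eq ▸ hpos))
  exact ⟨_, _, Nat.gcd_pos_of_pos_left k hpos,
    (Nat.gcd_le_right _ (Nat.pos_of_ne_zero hk₀)).trans hk, hT.minimalPeriod_dvd_or_eq h₀, hT_eq⟩

end HasIntegralLift

/-! ### Clopen sets -/

theorem isFiniteUnionOfBalls_of_isClopen {E : Set (P1 p)} (hE : IsClopen E) :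
    IsFiniteUnionOfBalls p E := by
  have hball (x : P1 p) (hx : x ∈ E) : ∃ n : ℕ, 1 ≤ n ∧ sphBall p n x ⊆ E := by
    obtain ⟨ε, hε, hεE⟩ := Metric.isOpen_iff.mp hE.isOpen x hx
    obtain ⟨n, hn⟩ := PadicInt.exists_pow_neg_lt p (lt_min hε one_pos)
    refine ⟨n, Nat.one_le_iff_ne_zero.mpr ?_,
      (Metric.closedBall_subset_ball (hn.trans_le (min_le_left _ _))).trans hεE⟩
    rintro rfl
    simp at hn
  choose n hn hnE using hball
  obtain ⟨t, ht⟩ := hE.isClosed.isCompact.elim_nhds_subcover'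
    (fun x hx => sphBall p (n x hx) x) fun x _ => Metric.closedBall_mem_nhds x
      (zpow_pos (by exact_mod_cast (Fact.out : p.Prime).pos) _)
  refine ⟨(fun x : E => (n x x.2, (x : P1 p))) '' t, t.finite_toSet.image _, ?_, ?_⟩
  · rintro _ ⟨x, -, rfl⟩
    exact hn x x.2
  · rw [Set.biUnion_image]
    exact ht.antisymm (Set.iUnion₂_subset fun x _ => hnE x x.2)

theorem countable_isMinimalComponent (φ : P1 p → P1 p) : {E | IsMinimalComponent φ E}.Countable :=
  (pairwiseDisjoint_isMinimalComponent φ).countable_of_isOpen (fun _ hE => hE.2.1.isOpen)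
    fun _ hE => hE.1

/-! ### Rational functions in homogeneous coordinates -/

section RationalFunction

variable {K : Type*} [Field K] {f g : K[X]} {ψ : RatFunc K}

theorem exists_eq_mul_num_and_eq_mul_denom (hg : g ≠ 0)
    (hψ : ψ = algebraMap K[X] (RatFunc K) f / algebraMap K[X] (RatFunc K) g) :
    ∃ h : K[X], h ≠ 0 ∧ f = h * ψ.num ∧ g = h * ψ.denom := by
  obtain ⟨h, hgh⟩ : ψ.denom ∣ g := hψ ▸ RatFunc.denom_div_dvd f g
  have hcross : ψ.num * g = f * ψ.denom := (RatFunc.num_mul_eq_mul_denom_iff hg).mpr hψ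
  refine ⟨h, right_ne_zero_of_mul (hgh ▸ hg), mul_right_cancel₀ ψ.denom_ne_zero ?_,
    hgh.trans (mul_comm _ _)⟩
  linear_combination ψ.num * hgh - hcross

theorem exists_eq_C_mul_num_and_eq_C_mul_denom (hg : g ≠ 0)
    (hψ : ψ = algebraMap K[X] (RatFunc K) f / algebraMap K[X] (RatFunc K) g)
    (hdeg : max f.natDegree g.natDegree ≤ ratDegree ψ) :
    ∃ c : K, c ≠ 0 ∧ f = Polynomial.C c * ψ.num ∧ g = Polynomial.C c * ψ.denom := by
  obtain ⟨h, h0, rfl, rfl⟩ := exists_eq_mul_num_and_eq_mul_denom hg hψ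
  suffices hh : h.natDegree = 0 by
    obtain ⟨c, rfl⟩ := Polynomial.natDegree_eq_zero.mp hh
    exact ⟨c, Polynomial.C_ne_zero.mp h0, rfl, rfl⟩
  rw [ratDegree, max_le_iff, Polynomial.natDegree_mul h0 ψ.denom_ne_zero] at hdeg
  rcases eq_or_ne ψ.num 0 with hn | hn
  · rw [hn, Polynomial.natDegree_zero] at hdeg
    omega
  · rw [Polynomial.natDegree_mul h0 hn] at hdeg
    omega

theorem ratDegree_eq_max_of_isCoprime (hfg : IsCoprime f g) (hg : g ≠ 0)
    (hψ : ψ = algebraMap K[X] (RatFunc K) f / algebraMap K[X] (RatFunc K) g) :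
    ratDegree ψ = max f.natDegree g.natDegree := by
  obtain ⟨h, h0, rfl, rfl⟩ := exists_eq_mul_num_and_eq_mul_denom hg hψ
  obtain ⟨c, hc, rfl⟩ := Polynomial.isUnit_iff.mp
    (hfg.isUnit_of_dvd' (dvd_mul_right _ _) (dvd_mul_right _ _))
  rw [ratDegree, Polynomial.natDegree_C_mul hc.ne_zero, Polynomial.natDegree_C_mul hc.ne_zero]

/-- The homogenizations of degree `d` of `f` and `g`. -/
noncomputable def homForms {R : Type*} [CommSemiring R] (d : ℕ) (f g : R[X]) :
    Fin 2 → MvPolynomial (Fin 2) R :=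
  ![f.homogenize d, g.homogenize d]

theorem homForms_map {R S : Type*} [CommSemiring R] [CommSemiring S] (σ : R →+* S) (d : ℕ)
    (f g : R[X]) : homForms d (f.map σ) (g.map σ) = MvPolynomial.map σ ∘ homForms d f g := by
  ext1 i
  fin_cases i <;> simp [homForms, Polynomial.homogenize_map]

theorem polyMap_map {R S ι : Type*} [CommSemiring R] [CommSemiring S] (σ : R →+* S)
    (Φ : ι → MvPolynomial ι R) (v : ι → R) :
    polyMap (MvPolynomial.map σ ∘ Φ) (σ ∘ v) = σ ∘ polyMap Φ v := by
  ext i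
  simp [polyMap, MvPolynomial.eval_map, MvPolynomial.eval₂_comp]

theorem homEval_eq_eval_homogenize (d : ℕ) (f : K[X]) (v : Fin 2 → K) :
    homEval d f v = MvPolynomial.eval v (f.homogenize d) := by
  simp only [homEval, Polynomial.homogenize, Finset.Nat.sum_antidiagonal_eq_sum_range_succ_mk,
    map_sum, MvPolynomial.eval_monomial]
  refine Finset.sum_congr rfl fun i _ => ?_
  simp [Finsupp.prod_fintype, Fin.prod_univ_two, mul_assoc]

theorem homLift_eq_polyMap (φ : RatFunc K) :
    homLift φ = polyMap (homForms (ratDegree φ) φ.num φ.denom) := by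
  ext v i
  fin_cases i <;> exact homEval_eq_eval_homogenize _ _ _

theorem exists_polyMap_homForms_eq_smul (hg : g ≠ 0)
    (hψ : ψ = algebraMap K[X] (RatFunc K) f / algebraMap K[X] (RatFunc K) g)
    (hdeg : max f.natDegree g.natDegree ≤ ratDegree ψ) :
    ∃ c : K, c ≠ 0 ∧ ∀ v, polyMap (homForms (ratDegree ψ) f g) v = c • homLift ψ v := by
  obtain ⟨c, hc, rfl, rfl⟩ := exists_eq_C_mul_num_and_eq_C_mul_denom hg hψ hdeg
  refine ⟨c, hc, fun v => ?_⟩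
  rw [homLift_eq_polyMap]
  ext i
  fin_cases i <;> simp [polyMap, homForms]

theorem polyMap_homForms_ne_zero (hg : g ≠ 0)
    (hψ : ψ = algebraMap K[X] (RatFunc K) f / algebraMap K[X] (RatFunc K) g)
    (hdeg : max f.natDegree g.natDegree ≤ ratDegree ψ) {v : Fin 2 → K} (hv : v ≠ 0) :
    polyMap (homForms (ratDegree ψ) f g) v ≠ 0 := by
  obtain ⟨c, hc, h⟩ := exists_polyMap_homForms_eq_smul hg hψ hdeg
  rw [h]
  exact smul_ne_zero hc (homLift_ne_zero ψ hv)

end RationalFunction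

theorem isCoprime_iff_toZMod_comp_ne_zero {v : Fin 2 → ℤ_[p]} :
    IsCoprime (v 0) (v 1) ↔ PadicInt.toZMod ∘ v ≠ 0 := by
  refine ⟨fun hv h => not_forall_prime_dvd_of_isCoprime hv fun i =>
    toZMod_eq_zero_iff_dvd.mp (congrFun h i), fun h => ?_⟩
  obtain ⟨i, hi⟩ := Function.ne_iff.mp h
  obtain ⟨s, hs⟩ := (PadicInt.isUnit_iff.mpr
    (norm_eq_one_of_not_dvd (mt toZMod_eq_zero_iff_dvd.mpr hi))).exists_left_inv
  fin_cases i
  · exact ⟨s, 0, by simpa using hs⟩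
  · exact ⟨0, s, by simpa using hs⟩

theorem GoodReduction.hasIntegralLift {φ : RatFunc ℚ_[p]} (h : GoodReduction p φ)
    (hdeg : 1 ≤ ratDegree φ) : HasIntegralLift (ratMap φ) := by
  obtain ⟨f, g, hfg, hφ, hg, -, hred⟩ := h
  have hinj : Function.Injective (algebraMap ℤ_[p] ℚ_[p]) := IsFractionRing.injective _ _
  have hg' := (Polynomial.map_ne_zero_iff hinj).mpr hg
  have hd := ratDegree_eq_max_of_isCoprime hfg hg' hφ
  obtain ⟨c, hc, hlift⟩ := exists_polyMap_homForms_eq_smul hg' hφ hd.ge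
  rw [Polynomial.natDegree_map_eq_of_injective hinj,
    Polynomial.natDegree_map_eq_of_injective hinj] at hd
  have hgbar : g.map (PadicInt.toZMod (p := p)) ≠ 0 := fun h0 => by
    rw [h0, map_zero, div_zero, ratDegree, RatFunc.num_zero, RatFunc.denom_zero] at hred
    simp only [Polynomial.natDegree_zero, Polynomial.natDegree_one, max_self] at hred
    omega
  refine ⟨homForms (ratDegree φ) f g, fun v hv => ?_⟩
  have hcop : IsCoprime (polyMap (homForms (ratDegree φ) f g) v 0)
      (polyMap (homForms (ratDegree φ) f g) v 1) := by
    have hdegbar := max_le_max (Polynomial.natDegree_map_le (f := PadicInt.toZMod) (p := f))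
      (Polynomial.natDegree_map_le (f := PadicInt.toZMod) (p := g))
    rw [isCoprime_iff_toZMod_comp_ne_zero, ← polyMap_map, ← homForms_map, ← hred]
    exact polyMap_homForms_ne_zero hgbar rfl (hdegbar.trans_eq (hd.symm.trans hred.symm))
      (isCoprime_iff_toZMod_comp_ne_zero.mp hv)
  refine ⟨hcop, (Projectivization.mk_eq_mk_iff' ..).mpr ⟨c⁻¹, ?_⟩⟩
  change c⁻¹ • (algebraMap ℤ_[p] ℚ_[p] ∘ polyMap (homForms (ratDegree φ) f g) v) =
    homLift φ (algebraMap ℤ_[p] ℚ_[p] ∘ v)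
  rw [← polyMap_map, ← homForms_map, hlift, inv_smul_smul₀ hc]

/-! ### Iterates of a rational map have finitely many fixed points -/

section Iterate

/-- The polynomials defining the `n`-th iterate of `polyMap Φ`. -/
noncomputable def iterForms {R σ : Type*} [CommSemiring R] (Φ : σ → MvPolynomial σ R) :
    ℕ → σ → MvPolynomial σ R
  | 0 => MvPolynomial.X
  | n + 1 => fun i => MvPolynomial.bind₁ (iterForms Φ n) (Φ i)

section

variable {R S σ : Type*} [CommSemiring R] [CommSemiring S] (Φ : σ → MvPolynomial σ R)

theorem polyMap_iterForms (n : ℕ) : polyMap (iterForms Φ n) = (polyMap Φ)^[n] := by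
  induction n with
  | zero => ext; simp [polyMap, iterForms]
  | succ n ih =>
    ext v i
    rw [Function.iterate_succ_apply', ← ih]
    exact MvPolynomial.eval₂Hom_bind₁ _ _ _ _

theorem iterForms_map (f : R →+* S) (n : ℕ) :
    iterForms (MvPolynomial.map f ∘ Φ) n = MvPolynomial.map f ∘ iterForms Φ n := by
  induction n with
  | zero => ext1 i; simp [iterForms]
  | succ n ih =>
    ext1 i
    simp only [iterForms, ih, Function.comp_apply, MvPolynomial.map_bind₁]
    rfl

variable {Φ} in
theorem isHomogeneous_iterForms {d : ℕ} (hΦ : ∀ i, (Φ i).IsHomogeneous d) (n : ℕ) (i : σ) :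
    (iterForms Φ n i).IsHomogeneous (d ^ n) := by
  induction n generalizing i with
  | zero => exact MvPolynomial.isHomogeneous_X R i
  | succ n ih => exact (hΦ i).aeval _ ih

end

/-- Setting the second variable to `1` in a form in two variables. -/
noncomputable def dehomogenize {R : Type*} [CommSemiring R] (F : MvPolynomial (Fin 2) R) : R[X] :=
  MvPolynomial.aeval ![Polynomial.X, 1] F

theorem dehomogenize_map {R S : Type*} [CommSemiring R] [CommSemiring S] (σ : R →+* S)
    (F : MvPolynomial (Fin 2) R) :
    dehomogenize (MvPolynomial.map σ F) = (dehomogenize F).map σ := by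
  induction F using MvPolynomial.induction_on with
  | C a => simp [dehomogenize]
  | add F G hF hG => simp_all [dehomogenize]
  | mul_X F i hF => fin_cases i <;> simp_all [dehomogenize]

section

variable {K : Type*} [Field K]

theorem eval_dehomogenize (z : K) (F : MvPolynomial (Fin 2) K) :
    (dehomogenize F).eval z = MvPolynomial.eval ![z, 1] F := by
  rw [dehomogenize, MvPolynomial.aeval_def, MvPolynomial.polynomial_eval_eval₂,
    ← MvPolynomial.eval₂_id]
  congr 1
  · ext
    simp
  · ext i
    fin_cases i <;> simp

/-- If the two sides agree, then `Ψ 1` is a power of the second variable, up to a constant: a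
root of its dehomogenization would be a common zero. But then `(1, 0)` is a common zero. -/
theorem dehomogenize_ne_X_mul_dehomogenize [IsAlgClosed K] {D : ℕ} (hD : 2 ≤ D)
    {Ψ : Fin 2 → MvPolynomial (Fin 2) K} (hΨ : ∀ i, (Ψ i).IsHomogeneous D)
    (hne : ∀ v ≠ 0, polyMap Ψ v ≠ 0) :
    dehomogenize (Ψ 0) ≠ Polynomial.X * dehomogenize (Ψ 1) := by
  intro heq
  rcases eq_or_ne (dehomogenize (Ψ 1)).degree 0 with hdeg | hdeg
  · obtain ⟨c, hc⟩ := Polynomial.natDegree_eq_zero.mp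
      (Polynomial.natDegree_eq_of_degree_eq_some hdeg)
    rw [← hc, mul_comm] at heq
    have h0 := Polynomial.homogenize_eq_of_isHomogeneous (hΨ 0) heq
    have h1 := Polynomial.homogenize_eq_of_isHomogeneous (hΨ 1) hc.symm
    rw [Polynomial.homogenize_C_mul, Polynomial.homogenize_X (by omega)] at h0
    rw [Polynomial.homogenize_C] at h1
    refine hne ![1, 0] (by simp) (funext <| Fin.forall_fin_two.mpr ⟨?_, ?_⟩)
    · simp [polyMap, ← h0, show D - 1 ≠ 0 by omega]
    · simp [polyMap, ← h1, show D ≠ 0 by omega]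
  · obtain ⟨z, hz⟩ := IsAlgClosed.exists_root _ hdeg
    rw [Polynomial.IsRoot] at hz
    refine hne ![z, 1] (by simp) (funext <| Fin.forall_fin_two.mpr ⟨?_, ?_⟩)
    · simp [polyMap, ← eval_dehomogenize, heq, hz]
    · simp [polyMap, ← eval_dehomogenize, hz]

variable {φ : RatFunc K}

theorem polyMap_map_homForms_ne_zero {L : Type*} [Field L] (σ : K →+* L) {v : Fin 2 → L}
    (hv : v ≠ 0) :
    polyMap (MvPolynomial.map σ ∘ homForms (ratDegree φ) φ.num φ.denom) v ≠ 0 := by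
  have hg : φ.denom.map σ ≠ 0 := (Polynomial.map_ne_zero_iff σ.injective).mpr φ.denom_ne_zero
  have hd := ratDegree_eq_max_of_isCoprime
    (φ.isCoprime_num_denom.map (Polynomial.mapRingHom σ)) hg rfl
  have hd' := hd
  simp only [Polynomial.coe_mapRingHom, Polynomial.natDegree_map] at hd'
  rw [← homForms_map, ratDegree, ← hd']
  exact polyMap_homForms_ne_zero hg rfl hd.ge hv

theorem dehomogenize_iterForms_ne (hd : 2 ≤ ratDegree φ) {n : ℕ} (hn : n ≠ 0) :
    dehomogenize (iterForms (homForms (ratDegree φ) φ.num φ.denom) n 0) ≠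
      Polynomial.X * dehomogenize (iterForms (homForms (ratDegree φ) φ.num φ.denom) n 1) := by
  set Φ := homForms (ratDegree φ) φ.num φ.denom
  let σ := algebraMap K (AlgebraicClosure K)
  have hΦ (i) : (Φ i).IsHomogeneous (ratDegree φ) := by
    fin_cases i <;> exact Polynomial.isHomogeneous_homogenize _
  have hne (v : Fin 2 → AlgebraicClosure K) (hv : v ≠ 0) :
      polyMap (MvPolynomial.map σ ∘ iterForms Φ n) v ≠ 0 := by
    rw [← iterForms_map, polyMap_iterForms]
    exact Set.MapsTo.iterate (s := {0}ᶜ) (fun _ => polyMap_map_homForms_ne_zero σ) n hv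
  intro h
  refine dehomogenize_ne_X_mul_dehomogenize (hd.trans (Nat.le_self_pow hn _))
    (fun i => (isHomogeneous_iterForms hΦ n i).map σ) hne ?_
  simp only [dehomogenize_map, h, Polynomial.map_mul, Polynomial.map_X]

theorem iterate_ratMap_mk (n : ℕ) {v : Fin 2 → K} (hv : v ≠ 0) :
    ∃ h, (ratMap φ)^[n] (Projectivization.mk K v hv) =
      Projectivization.mk K ((homLift φ)^[n] v) h := by
  induction n with
  | zero => exact ⟨hv, rfl⟩
  | succ n ih =>
    obtain ⟨h, hn⟩ := ih
    simp only [Function.iterate_succ_apply', hn]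
    exact ⟨homLift_ne_zero φ h, rfl⟩

theorem finite_fixedPoints_iterate (hd : 2 ≤ ratDegree φ) {n : ℕ} (hn : n ≠ 0) :
    {P | (ratMap φ)^[n] P = P}.Finite := by
  set Ψ := iterForms (homForms (ratDegree φ) φ.num φ.denom) n
  let q : K[X] := dehomogenize (Ψ 0) - Polynomial.X * dehomogenize (Ψ 1)
  have hq : q ≠ 0 := sub_ne_zero.mpr (dehomogenize_iterForms_ne hd hn)
  let pt (z : K) : ℙ K (Fin 2 → K) := Projectivization.mk K ![z, 1] (by simp)
  have hroot (z : K) (hz : (ratMap φ)^[n] (pt z) = pt z) : q.IsRoot z := by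
    obtain ⟨_, hz'⟩ := iterate_ratMap_mk (φ := φ) n (v := ![z, 1]) (by simp)
    obtain ⟨t, ht⟩ := (Projectivization.mk_eq_mk_iff' ..).mp (hz'.symm.trans hz)
    rw [homLift_eq_polyMap, ← polyMap_iterForms] at ht
    have h0 : t * z = MvPolynomial.eval ![z, 1] (Ψ 0) := congrFun ht 0
    have h1 : t * 1 = MvPolynomial.eval ![z, 1] (Ψ 1) := congrFun ht 1
    simp only [q, Polynomial.IsRoot, Polynomial.eval_sub, Polynomial.eval_mul,
      Polynomial.eval_X, eval_dehomogenize, ← h0, ← h1]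
    ring
  refine (((Polynomial.finite_setOfPred_isRoot hq).image pt).insert
    (Projectivization.mk K ![1, 0] (by simp))).subset fun P hP => ?_
  induction P using Projectivization.ind with | _ v hv
  by_cases hv1 : v 1 = 0
  · refine .inl ((Projectivization.mk_eq_mk_iff' ..).mpr ⟨v 0, ?_⟩)
    ext i
    fin_cases i <;> simp [hv1]
  · have hpt : Projectivization.mk K v hv = pt (v 0 / v 1) := mk_eq_mk_div_one hv hv1
    exact .inr ⟨v 0 / v 1, hroot _ (hpt ▸ hP), hpt.symm⟩

end

end Iterate

theorem finite_periodicPts {φ : RatFunc ℚ_[p]} (hφ : HasIntegralLift (ratMap φ))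
    (hd : 2 ≤ ratDegree φ) : (Function.periodicPts (ratMap φ)).Finite := by
  refine (Set.Finite.biUnion (Set.finite_Icc 1 ((p + 1) * p)) fun n hn =>
    finite_fixedPoints_iterate hd (Nat.one_le_iff_ne_zero.mp hn.1)).subset fun y hy =>
    Set.mem_biUnion ⟨Function.minimalPeriod_pos_of_mem_periodicPts hy, ?_⟩
      Function.iterate_minimalPeriod
  obtain ⟨k, m, -, hk, hm, h⟩ := hφ.exists_minimalPeriod_eq_mul hy
  have hp := (Fact.out : p.Prime).two_le
  have hmp : m ≤ p := by
    rcases hm with hm | ⟨-, hm⟩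
    · exact (Nat.le_of_dvd (by omega) hm).trans (Nat.sub_le p 1)
    · exact hm.le
  exact h.trans_le (Nat.mul_le_mul hk hmp)

end PadicRat

theorem theorem1p2 (p : ℕ) [Fact p.Prime] (φ : RatFunc ℚ_[p])
    (hdeg : 2 ≤ PadicRat.ratDegree φ) (hgood : PadicRat.GoodReduction p φ) :
    (∃ P M B : Set (PadicRat.P1 p),
      -- the decomposition
      P ∪ M ∪ B = Set.univ ∧ Disjoint P M ∧ Disjoint P B ∧ Disjoint M B ∧
      -- the periodic part
      P = Function.periodicPts (PadicRat.ratMap φ) ∧ P.Finite ∧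
      -- the minimal part
      M = ⋃₀ {E | PadicRat.IsMinimalComponent (PadicRat.ratMap φ) E} ∧
      {E | PadicRat.IsMinimalComponent (PadicRat.ratMap φ) E}.Countable ∧
      {E | PadicRat.IsMinimalComponent (PadicRat.ratMap φ) E}.PairwiseDisjoint id ∧
      (∀ E, PadicRat.IsMinimalComponent (PadicRat.ratMap φ) E →
        PadicRat.IsFiniteUnionOfBalls p E) ∧
      -- the attracted part
      (∀ x ∈ B,
        (∃ y ∈ Function.periodicPts (PadicRat.ratMap φ),
          x ∈ PadicRat.basin (PadicRat.ratMap φ) (PadicRat.orbit (PadicRat.ratMap φ) y)) ∨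
        (∃ E, PadicRat.IsMinimalComponent (PadicRat.ratMap φ) E ∧
          x ∈ PadicRat.basin (PadicRat.ratMap φ) E))) ∧
    -- the lengths of the periodic orbits
    (∀ y ∈ Function.periodicPts (PadicRat.ratMap φ),
      ∃ k ℓ : ℕ, 1 ≤ k ∧ k ≤ p + 1 ∧ ℓ ∣ p - 1 ∧
        (Function.minimalPeriod (PadicRat.ratMap φ) y = k ∨
          Function.minimalPeriod (PadicRat.ratMap φ) y = k * ℓ ∨
          ((p = 2 ∨ p = 3) ∧ Function.minimalPeriod (PadicRat.ratMap φ) y = k * p))) := by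
  have hφ := hgood.hasIntegralLift (one_le_two.trans hdeg)
  set T := PadicRat.ratMap φ
  let P := Function.periodicPts T
  let M := ⋃₀ {E | PadicRat.IsMinimalComponent T E}
  refine ⟨⟨P, M, (P ∪ M)ᶜ, Set.union_compl_self _,
    Set.disjoint_sUnion_right.mpr fun E hE => hE.disjoint_periodicPts,
    disjoint_compl_right.mono_left Set.subset_union_left,
    disjoint_compl_right.mono_left Set.subset_union_right,
    rfl, PadicRat.finite_periodicPts hφ hdeg, rfl, PadicRat.countable_isMinimalComponent T,
    PadicRat.pairwiseDisjoint_isMinimalComponent T,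
    fun E hE => PadicRat.isFiniteUnionOfBalls_of_isClopen hE.2.1,
    fun x _ => hφ.exists_mem_basin x⟩, fun y hy => ?_⟩
  obtain ⟨k, m, hk, hkp, hm | ⟨hp, rfl⟩, hkm⟩ := hφ.exists_minimalPeriod_eq_mul hy
  · exact ⟨k, m, hk, hkp, hm, .inr (.inl hkm)⟩
  · exact ⟨k, 1, hk, hkp, one_dvd _, .inr (.inr ⟨hp, hkm⟩)⟩
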